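/- Let $X$ be a finite alphabet with $|X|\ge 2$, let $X^*$ be the set of finite words and $X^\omega$ the set of (right) infinite words over $X$, and let $K$ be a field. Let $G$ be a self-similar group over $X$: a group acting faithfully on $X^*$ by length-preserving permutations such that for all $g\in G$, $x\in X$ there is $g|_x\in G$ with $g(xw)=g(x)\,g|_x(w)$ for all $w\in X^*$; put $g|_{xw}=(g|_x)|_w$ for words. The group $G$ acts on $X^\omega$ by $g(x_1x_2x_3\cdots)=g(x_1)\,g|_{x_1}(x_2)\,g|_{x_1x_2}(x_3)\cdots$. Let $S$ be the associated inverse semigroup. It consists of $0$ and the elements $ugv^*$ with $u,v\in X^*$, $g\in G$ (uniquely written so), and its product is determined by $g\cdot h=gh$, $g^*=g^{-1}$, $gx=g(x)g|_x$ and $x^*y=\delta_{x,y}$ for $g,h\in G$, $x,y\in X$, the identity of $G$ and the empty word being the identity of $S$. Let $E(S)$ be its set of idempotents, with $f\le e$ if and only if $fe=f$. Let $K_0S$ be the contracted semigroup algebra: the $K$-algebra with basis $S\setminus\{0\}$ whose multiplication extends that of $S$, the zeroes of $S$ and $K$ being identified. - A finite set $F\subseteq E(S)$ covers $e\in E(S)$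 if $f\le e$ for all $f\in F$ and for every $f'\in E(S)$ with $0\ne f'\le e$ there is $f\in F$ with $f'f\neq 0$. The tight ideal $\mathrm{Tight}$ of $K_0S$ is the ideal generated by all products $\prod_{f\in F}(e-f)$ with $e\in E(S)$ and $F$ a finite cover of $e$ (the empty product being $e$). - $\mathrm{Sing}\subseteq K_0S$, the singular ideal, is the set of all $a\in K_0S$ such that for every $0\ne e\in E(S)$ there is $f\in E(S)$ with $0\neq f\le e$ and $af=0$. - The Nekrashevych algebra $\mathcal N$ of $(G,X)$ over $K$ is the unital $*$-algebra over $K$ (with trivial involution on $K$) generated by $X\cup G$, the identity of $G$ being the identity of the algebra, with relations $g^*=g^{-1}$, $g\cdot h=gh$, $gx=g(x)g|_x$, $y^*x=\delta_{x,y}$ for $g,h\in G$, $x,y\in X$, and $\sum_{x\in X}xx^*=1$. - $S$ acts on $X^\omega$ by partial maps, $ugv^*$ mapping $vw$ to $ug(w)$ for $w\in X^\omega$ and being undefined on words without prefix $v$. This gives a representation of $K_0S$ on the vector space $KX^\omega$ with basis $X^\omega$ (undefined values being replaced by $0$), and likewise a representation of $\mathcal N$ on $KX^\omega$, in which the generators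 $x$, $x^*$, $g$ act by the corresponding partial maps. Theorem. The kernel of the representation of $K_0S$ on $KX^\omega$ is $\mathrm{Sing}$. The canonical homomorphism $K_0S\to\mathcal N$, $ugv^*\mapsto ugv^*$, is surjective with kernel $\mathrm{Tight}$, and the representation of $\mathcal N$ on $KX^\omega$ composed with it is that of $K_0S$. Moreover $\mathrm{Tight}\subseteq\mathrm{Sing}$, and under the resulting identification $\mathcal N=K_0S/\mathrm{Tight}$ the kernel of the representation of $\mathcal N$ on $KX^\omega$ is $\mathrm{Sing}/\mathrm{Tight}$. Consequently $\mathcal N$ is simple (that is, nonzero with no two-sided ideals other than $0$ and $\mathcal N$) if and only if its representation on $KX^\omega$ is faithful. -/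

import Mathlib

noncomputable section

namespace Nekrashevych

/-! ### Self-similar groups -/

/-- A self-similar group over the alphabet `X`: a group `G` with a faithful, length-preserving
action on the words over `X` such that for all `g : G` and `x : X` there is a section
`g|ₓ : G` with `g (x w) = g (x) g|ₓ (w)` for all words `w`. -/
class SelfSimilarGroup (G X : Type*) [Group G] extends MulAction G (List X) where
  faithful : ∀ g h : G, (∀ w : List X, g • w = h • w) → g = h
  length_smul : ∀ (g : G) (w : List X), (g • w).length = w.length
  exists_section : ∀ (g : G) (x : X), ∃ h : G, ∀ w : List X, g • (x :: w) = g • [x] ++ h • w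

section Sections

variable {G X : Type*} [Group G] [SelfSimilarGroup G X]

open SelfSimilarGroup

theorem smul_singleton_ne_nil (g : G) (x : X) : g • [x] ≠ [] := by
  intro h
  have := length_smul g [x]
  simp [h] at this

/-- The letter `g (x)`. -/
def letter (g : G) (x : X) : X := (g • [x]).head (smul_singleton_ne_nil g x)

theorem smul_singleton (g : G) (x : X) : g • [x] = [letter g x] := by
  have h := length_smul g [x]
  obtain ⟨y, hy⟩ := List.length_eq_one_iff.1 (by simpa using h)
  simp [letter, hy]

/-- The section `g|ₓ` of `g` at the letter `x`. -/
def sec (g : G) (x : X) : G := (exists_section g x).choose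

theorem smul_cons (g : G) (x : X) (w : List X) : g • (x :: w) = letter g x :: sec g x • w := by
  have h := (exists_section g x).choose_spec w
  exact h.trans (congrArg (· ++ sec g x • w) (smul_singleton g x))

/-- The section `g|_w` of `g` at the word `w`. -/
def secW : G → List X → G
  | g, [] => g
  | g, x :: w => secW (sec g x) w

theorem smul_nil (g : G) : g • ([] : List X) = [] :=
  List.length_eq_zero_iff.1 (by simp [length_smul])

theorem smul_append (g : G) (u v : List X) : g • (u ++ v) = g • u ++ secW g u • v := by
  induction u generalizing g with
  | nil => simp [smul_nil, secW]
  | cons x u ih => simp [smul_cons, secW, ih]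

theorem secW_append (g : G) (u v : List X) : secW g (u ++ v) = secW (secW g u) v := by
  induction u generalizing g with
  | nil => rfl
  | cons x u ih => simp [secW, ih]

theorem secW_mul (g h : G) (w : List X) : secW (g * h) w = secW g (h • w) * secW h w := by
  apply faithful (X := X)
  intro v
  have h1 : (g * h) • (w ++ v) = g • h • (w ++ v) := mul_smul g h (w ++ v)
  rw [smul_append, smul_append, smul_append, mul_smul] at h1
  rw [mul_smul]
  exact List.append_cancel_left h1

theorem secW_one (w : List X) : secW (1 : G) w = 1 := by
  apply faithful (X := X)
  intro v
  have h1 : (1 : G) • (w ++ v) = w ++ v := one_smul G (w ++ v)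
  rw [smul_append, one_smul] at h1
  rw [one_smul]
  exact List.append_cancel_left h1

theorem secW_inv_mul (g : G) (w : List X) : secW g (g⁻¹ • w) = (secW g⁻¹ w)⁻¹ := by
  rw [eq_inv_iff_mul_eq_one, ← secW_mul, mul_inv_cancel, secW_one]

/-- The action of `g` on infinite words,
`g (x₁ x₂ x₃ ⋯) = g (x₁) g|_{x₁} (x₂) g|_{x₁ x₂} (x₃) ⋯`. -/
def omegaAct (g : G) (w : Stream' X) : Stream' X := fun n => letter (secW g (w.take n)) (w.get n)

theorem smul_take (g : G) (w : Stream' X) (n : ℕ) : g • w.take n = (omegaAct g w).take n := by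
  induction n with
  | zero => simp [smul_nil]
  | succ n ih =>
    rw [Stream'.take_succ', Stream'.take_succ', smul_append, smul_singleton, ih]
    rfl

theorem omegaAct_one (w : Stream' X) : omegaAct (1 : G) w = w := by
  apply Stream'.take_theorem
  intro n
  rw [← smul_take, one_smul]

theorem omegaAct_mul (g h : G) (w : Stream' X) :
    omegaAct (g * h) w = omegaAct g (omegaAct h w) := by
  apply Stream'.take_theorem
  intro n
  rw [← smul_take, ← smul_take, ← smul_take, mul_smul]

theorem omegaAct_cons (g : G) (x : X) (w : Stream' X) :
    omegaAct g (Stream'.cons x w) = Stream'.cons (letter g x) (omegaAct (sec g x) w) := by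
  funext n
  cases n <;> rfl

theorem omegaAct_append (g : G) (u : List X) (w : Stream' X) :
    omegaAct g (u ++ₛ w) = (g • u) ++ₛ omegaAct (secW g u) w := by
  induction u generalizing g with
  | nil => simp [smul_nil, secW]
  | cons x u ih =>
    rw [Stream'.cons_append_stream, omegaAct_cons, ih, smul_cons, Stream'.cons_append_stream, secW]

end Sections

/-! ### The associated inverse semigroup -/

/-- The inverse semigroup `S` of the self-similar group, whose elements are `0` and the elements
`mk u g v`, standing for `u g v*` with `u, v` words and `g : G`. -/
inductive InvSemi (G X : Type*) : Type _
  | zero : InvSemi G X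
  | mk (u : List X) (g : G) (v : List X) : InvSemi G X

section InvSemigroup

variable {G X : Type*} [Group G] [SelfSimilarGroup G X]

open SelfSimilarGroup

open scoped Classical in
/-- The product `(u g v*) (u' g' v'*)`:
if `u' = v z`, then `v* u' = z` and the product is `(u g(z)) (g|_z g') v'*`;
if `v = u' z`, then `v* u' = z*`, and the product is `u (g k⁻¹) (v' g'⁻¹(z))*` where
`k = g'⁻¹|_z`; otherwise it is `0`. -/
def InvSemi.mul : InvSemi G X → InvSemi G X → InvSemi G X
  | .mk u g v, .mk u' g' v' =>
    if v <+: u' then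
      .mk (u ++ g • u'.drop v.length) (secW g (u'.drop v.length) * g') v'
    else if u' <+: v then
      .mk u (g * (secW g'⁻¹ (v.drop u'.length))⁻¹) (v' ++ g'⁻¹ • v.drop u'.length)
    else .zero
  | _, _ => .zero

instance : Mul (InvSemi G X) := ⟨InvSemi.mul⟩

theorem zero_mul_aux (s : InvSemi G X) : InvSemi.zero * s = InvSemi.zero := rfl

theorem mul_zero_aux (s : InvSemi G X) : s * InvSemi.zero = InvSemi.zero := by
  cases s <;> rfl

theorem mk_mul_mk_left (u : List X) (g : G) (v z : List X) (g' : G) (v' : List X) :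
    InvSemi.mk u g v * InvSemi.mk (v ++ z) g' v' =
      InvSemi.mk (u ++ g • z) (secW g z * g') v' := by
  change InvSemi.mul _ _ = _
  simp [InvSemi.mul]

theorem mk_mul_mk_right (u : List X) (g : G) (u' z : List X) (g' : G) (v' : List X) :
    InvSemi.mk u g (u' ++ z) * InvSemi.mk u' g' v' =
      InvSemi.mk u (g * (secW g'⁻¹ z)⁻¹) (v' ++ g'⁻¹ • z) := by
  by_cases hz : z = []
  · subst hz
    have := mk_mul_mk_left u g u' [] g' v'
    simpa [secW, smul_nil] using this
  · change InvSemi.mul _ _ = _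
    have : ¬ (u' ++ z <+: u') := fun h => hz (by have := h.length_le; simpa using this)
    simp [InvSemi.mul, this]

theorem mk_mul_mk_nil (u : List X) (g : G) (u' : List X) (g' : G) (v' : List X) :
    InvSemi.mk u g [] * InvSemi.mk u' g' v' =
      InvSemi.mk (u ++ g • u') (secW g u' * g') v' :=
  mk_mul_mk_left u g [] u' g' v'

theorem mk_nil_mul_mk (u : List X) (g : G) (v : List X) (g' : G) (v' : List X) :
    InvSemi.mk u g v * InvSemi.mk [] g' v' =
      InvSemi.mk u (g * (secW g'⁻¹ v)⁻¹) (v' ++ g'⁻¹ • v) :=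
  mk_mul_mk_right u g [] v g' v'

theorem mk_mul_mk_incomp {u : List X} {g : G} {v u' : List X} {g' : G} {v' : List X}
    (h1 : ¬ v <+: u') (h2 : ¬ u' <+: v) :
    InvSemi.mk u g v * InvSemi.mk u' g' v' = InvSemi.zero := by
  change InvSemi.mul _ _ = _
  simp [InvSemi.mul, h1, h2]

/-- The partial map of `u g v*` on a set `Ω` of words (finite or infinite), as a relation:
`u g v*` maps `v c` to `u g(c)`. Here `app` is concatenation, `ga` the action of the group. -/
def ActRel {Ω : Type*} (app : List X → Ω → Ω) (ga : G → Ω → Ω) (s : InvSemi G X) (a b : Ω) :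
    Prop :=
  ∃ u g v c, s = InvSemi.mk u g v ∧ a = app v c ∧ b = app u (ga g c)

theorem actRel_mul {Ω : Type*} {app : List X → Ω → Ω} {ga : G → Ω → Ω}
    (happ : ∀ u v a, app (u ++ v) a = app u (app v a))
    (hga : ∀ g v c, ga g (app v c) = app (g • v) (ga (secW g v) c))
    (hmul : ∀ g h c, ga (g * h) c = ga g (ga h c)) (hone : ∀ c, ga 1 c = c)
    (hinj : ∀ u a b, app u a = app u b → a = b)
    (hcomp : ∀ u v a b, app u a = app v b → u <+: v ∨ v <+: u)
    (s t : InvSemi G X) (a b : Ω) :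
    ActRel app ga (s * t) a b ↔ ∃ c, ActRel app ga t a c ∧ ActRel app ga s c b := by
  have hinv : ∀ g c, ga g (ga g⁻¹ c) = c := fun g c => by rw [← hmul, mul_inv_cancel, hone]
  have hinv' : ∀ g c, ga g⁻¹ (ga g c) = c := fun g c => by rw [← hmul, inv_mul_cancel, hone]
  constructor
  · rintro ⟨u₀, g₀, v₀, c, h, rfl, rfl⟩
    rcases s with _ | ⟨u, g, v⟩
    · rw [zero_mul_aux] at h; cases h
    rcases t with _ | ⟨u', g', v'⟩
    · rw [mul_zero_aux] at h; cases h
    by_cases h1 : v <+: u'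
    · obtain ⟨z, rfl⟩ := h1
      rw [mk_mul_mk_left] at h
      cases h
      refine ⟨app (v ++ z) (ga g' c), ⟨_, _, _, c, rfl, rfl, rfl⟩,
        ⟨_, _, _, app z (ga g' c), rfl, happ _ _ _, ?_⟩⟩
      rw [hga, happ, hmul]
    by_cases h2 : u' <+: v
    · obtain ⟨z, rfl⟩ := h2
      rw [mk_mul_mk_right] at h
      cases h
      refine ⟨app u' (ga g' (app (g'⁻¹ • z) c)), ⟨_, _, _, _, rfl, happ _ _ _, rfl⟩,
        ⟨_, _, _, ga (secW g'⁻¹ z)⁻¹ c, rfl, ?_, ?_⟩⟩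
      · rw [hga, happ, smul_inv_smul, secW_inv_mul]
      · rw [hmul]
    · rw [mk_mul_mk_incomp h1 h2] at h; cases h
  · rintro ⟨m, ⟨u', g', v', c, rfl, rfl, hm⟩, ⟨u, g, v, d, rfl, hm', rfl⟩⟩
    rw [hm] at hm'
    rcases hcomp _ _ _ _ hm' with ⟨z, rfl⟩ | ⟨z, rfl⟩
    · rw [happ] at hm'
      have h1 := hinj _ _ _ hm'
      rw [mk_mul_mk_right]
      refine ⟨_, _, _, ga (secW g'⁻¹ z) d, rfl, ?_, ?_⟩
      · rw [happ, ← hga, ← h1, hinv']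
      · rw [hmul, ← hmul _⁻¹, inv_mul_cancel, hone]
    · rw [happ] at hm'
      have h1 := hinj _ _ _ hm'
      rw [mk_mul_mk_left]
      refine ⟨_, _, _, c, rfl, rfl, ?_⟩
      rw [happ, hmul, ← h1, hga]

/-- On finite words, `S` acts by partial maps ... -/
theorem actRel_mul_list (s t : InvSemi G X) (a b : List X) :
    ActRel (· ++ ·) (· • ·) (s * t) a b ↔
      ∃ c, ActRel (· ++ ·) (· • ·) t a c ∧ ActRel (· ++ ·) (· • ·) s c b := by
  apply actRel_mul
  · intro u v a; simp
  · intro g v c; exact smul_append g v c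
  · intro g h c; exact mul_smul g h c
  · intro c; exact one_smul G c
  · intro u a b h; exact List.append_cancel_left h
  · intro u v a b h
    exact List.prefix_or_prefix_of_prefix ⟨a, h⟩ ⟨b, rfl⟩

/-- ... and this action is faithful, so that `S` is a semigroup of partial maps. -/
theorem actRel_list_faithful {s t : InvSemi G X}
    (h : ∀ a b : List X, ActRel (· ++ ·) (· • ·) s a b ↔ ActRel (· ++ ·) (· • ·) t a b) :
    s = t := by
  have key : ∀ (u : List X) (g : G) (v w : List X),
      ActRel (· ++ ·) (· • ·) (InvSemi.mk u g v) (v ++ w) (u ++ g • w) :=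
    fun u g v w => ⟨u, g, v, w, rfl, rfl, rfl⟩
  rcases s with _ | ⟨u, g, v⟩ <;> rcases t with _ | ⟨u', g', v'⟩
  · rfl
  · obtain ⟨_, _, _, _, h', _⟩ := (h _ _).2 (key u' g' v' []); cases h'
  · obtain ⟨_, _, _, _, h', _⟩ := (h _ _).1 (key u g v []); cases h'
  · obtain ⟨_, _, _, c, h1, h2, h3⟩ := (h _ _).1 (key u g v [])
    obtain ⟨_, _, _, d, h1', h2', h3'⟩ := (h _ _).2 (key u' g' v' [])
    cases h1; cases h1'
    simp only [List.append_nil, smul_nil] at h2 h3 h2' h3'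
    have hc : c = [] := by
      have e1 := congrArg List.length h2
      have e2 := congrArg List.length h2'
      simp only [List.length_append] at e1 e2
      exact List.length_eq_zero_iff.1 (by omega)
    subst hc
    simp only [List.append_nil, smul_nil] at h2 h3
    subst h2; subst h3
    congr 1
    apply faithful (X := X)
    intro w
    obtain ⟨_, _, _, e, h1, h2, h3⟩ := (h _ _).1 (key u g v w)
    cases h1
    have := List.append_cancel_left h2
    subst this
    exact List.append_cancel_left h3

instance : MonoidWithZero (InvSemi G X) where
  mul_assoc a b c := by
    apply actRel_list_faithful
    intro x y
    simp only [actRel_mul_list]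
    constructor
    · rintro ⟨p, h1, q, h2, h3⟩; exact ⟨q, ⟨p, h1, h2⟩, h3⟩
    · rintro ⟨q, ⟨p, h1, h2⟩, h3⟩; exact ⟨p, h1, q, h2, h3⟩
  one := InvSemi.mk [] 1 []
  one_mul s := by
    rcases s with _ | ⟨u, g, v⟩
    · rfl
    · have := mk_mul_mk_left [] (1 : G) [] u g v
      simp only [List.nil_append, one_smul, secW_one, one_mul] at this
      exact this
  mul_one s := by
    rcases s with _ | ⟨u, g, v⟩
    · rfl
    · have := mk_mul_mk_right u g [] v (1 : G) []
      simp only [List.nil_append, inv_one, one_smul, secW_one, mul_one] at this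
      exact this
  zero := InvSemi.zero
  zero_mul := zero_mul_aux
  mul_zero := mul_zero_aux

theorem InvSemi.one_def : (1 : InvSemi G X) = InvSemi.mk [] 1 [] := rfl

theorem InvSemi.zero_def : (0 : InvSemi G X) = InvSemi.zero := rfl

open scoped Classical in
/-- The action of `S` on infinite words by partial maps: `u g v*` maps `v w` to `u g(w)`, and is
undefined (`none`) elsewhere. -/
def omegaPartial : InvSemi G X → Stream' X → Option (Stream' X)
  | .zero, _ => none
  | .mk u g v, w =>
    if w.take v.length = v then some (u ++ₛ omegaAct g (w.drop v.length)) else none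

theorem take_append_aux (v : List X) (c : Stream' X) : (v ++ₛ c).take v.length = v := by
  induction v with
  | nil => simp
  | cons x v ih => rw [Stream'.cons_append_stream, List.length_cons, Stream'.take_succ,
      Stream'.head_cons, Stream'.tail_cons, ih]

theorem omegaPartial_eq_some (s : InvSemi G X) (a b : Stream' X) :
    omegaPartial s a = some b ↔ ActRel (· ++ₛ ·) omegaAct s a b := by
  rcases s with _ | ⟨u, g, v⟩
  · constructor
    · intro h; cases h
    · rintro ⟨_, _, _, _, h, _⟩; cases h
  · constructor
    · intro h
      simp only [omegaPartial] at h
      split_ifs at h with h1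
      cases h
      refine ⟨u, g, v, a.drop v.length, rfl, ?_, rfl⟩
      conv_lhs => rw [← Stream'.append_take_drop v.length a, h1]
    · rintro ⟨_, _, _, c, h, rfl, rfl⟩
      cases h
      simp [omegaPartial, take_append_aux, Stream'.drop_append_stream]

theorem omegaPartial_mul (s t : InvSemi G X) (w : Stream' X) :
    omegaPartial (s * t) w = (omegaPartial t w).bind (omegaPartial s) := by
  apply Option.ext
  intro b
  rw [Option.bind_eq_some_iff]
  simp only [omegaPartial_eq_some]
  apply actRel_mul
  · intro u v a; exact Stream'.append_append_stream u v a
  · intro g v c; exact omegaAct_append g v c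
  · intro g h c; exact omegaAct_mul g h c
  · intro c; exact omegaAct_one c
  · intro u a b h
    have := congrArg (Stream'.drop u.length) h
    simpa [Stream'.drop_append_stream] using this
  · intro u v a b h
    have h1 : u <+: (u ++ₛ a).take (u.length + v.length) := by
      have h2 := Stream'.append_take_drop u.length ((u ++ₛ a))
      rw [Stream'.take_add, take_append_aux]
      exact ⟨_, rfl⟩
    have h2 : v <+: (v ++ₛ b).take (u.length + v.length) := by
      rw [add_comm, Stream'.take_add, take_append_aux]
      exact ⟨_, rfl⟩
    have h' : (u ++ₛ a) = (v ++ₛ b) := h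
    rw [h'] at h1
    exact List.prefix_or_prefix_of_prefix h1 h2

theorem omegaPartial_one (w : Stream' X) : omegaPartial (1 : InvSemi G X) w = some w := by
  rw [omegaPartial_eq_some]
  exact ⟨[], 1, [], w, rfl, rfl, by simp [omegaAct_one]⟩

end InvSemigroup

/-! ### Contracted semigroup algebras, tight and singular ideals -/

section Contracted

variable (K S : Type*) [Field K] [MonoidWithZero S]

theorem eq_single_zero_of_coeff {K S : Type*} [Field K] [MonoidWithZero S]
    {a : MonoidAlgebra K S} (ha : ∀ s : S, s ≠ 0 → a.coeff s = 0) :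
    a = MonoidAlgebra.single 0 (a.coeff 0) := by
  ext s
  by_cases hs : s = 0
  · subst hs; simp
  · simp [ha s hs, Ne.symm hs]

/-- The ideal `K · 0_S` of the semigroup algebra `K S`: it consists of the elements all of whose
coefficients at non-zero elements of `S` vanish. -/
def zeroIdeal : Ideal (MonoidAlgebra K S) where
  carrier := {a | ∀ s : S, s ≠ 0 → a.coeff s = 0}
  add_mem' := by
    intro a b ha hb s hs
    simp [ha s hs, hb s hs]
  zero_mem' := by
    intro s hs
    simp
  smul_mem' := by
    intro c a ha
    rw [eq_single_zero_of_coeff ha]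
    intro s hs
    induction c using MonoidAlgebra.induction_on with
    | of m => simp [MonoidAlgebra.single_mul_single, Ne.symm hs]
    | add x y hx hy =>
      simp only [smul_eq_mul] at hx hy ⊢
      simp [add_mul, hx, hy]
    | smul r x hx =>
      simp only [smul_eq_mul] at hx ⊢
      simp [hx]

instance : (zeroIdeal K S).IsTwoSided where
  mul_mem_of_left := by
    intro a c ha
    rw [eq_single_zero_of_coeff ha]
    intro s hs
    induction c using MonoidAlgebra.induction_on with
    | of m => simp [MonoidAlgebra.single_mul_single, Ne.symm hs]
    | add x y hx hy => simp [mul_add, hx, hy]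
    | smul r x hx => simp [hx]

/-- The contracted semigroup algebra `K₀S`: the semigroup algebra `K S` with the zero of `S`
identified with the zero of `K S`. -/
abbrev ContractedAlgebra : Type _ := MonoidAlgebra K S ⧸ zeroIdeal K S

variable {S}

/-- The element of `K₀S` given by an element of `S`. -/
def ofS (s : S) : ContractedAlgebra K S :=
  Ideal.Quotient.mkₐ K (zeroIdeal K S) (MonoidAlgebra.of K S s)

variable {K}

/-- The homomorphism from `K₀S` that extends a homomorphism of monoids with zero from `S`. -/
def contractedLift {A : Type*} [Semiring A] [Algebra K A] (f : S →*₀ A) :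
    ContractedAlgebra K S →ₐ[K] A :=
  Ideal.Quotient.liftₐ (zeroIdeal K S) (MonoidAlgebra.lift K A S (f : S →* A)) (by
    intro a ha
    rw [eq_single_zero_of_coeff ha, MonoidAlgebra.lift_single]
    simp)

theorem contractedLift_ofS {A : Type*} [Semiring A] [Algebra K A] (f : S →*₀ A) (s : S) :
    contractedLift (K := K) f (ofS K s) = f s := by
  change MonoidAlgebra.lift K A S (f : S →* A) (MonoidAlgebra.of K S s) = f s
  rw [MonoidAlgebra.lift_of]
  rfl

/-- The list `F` of idempotents covers the idempotent `e`: every `f ∈ F` is below `e`, and every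
non-zero idempotent below `e` has a non-zero meet with some `f ∈ F`. Here `f ≤ e` means
`f * e = f`. -/
structure IsCover (F : List S) (e : S) : Prop where
  idempotent : ∀ f ∈ F, IsIdempotentElem f
  le : ∀ f ∈ F, f * e = f
  meets : ∀ f', IsIdempotentElem f' → f' ≠ 0 → f' * e = f' → ∃ f ∈ F, f' * f ≠ 0

variable (K S)

/-- The tight ideal of `K₀S`, generated by the products `∏_{f ∈ F} (e - f)` with `e` an idempotent
and `F` a finite cover of `e`. The products are formed in the corner with identity `e`, that is,
the empty product is `e` (and occurs only for `e = 0`, as the empty set covers no other `e`). -/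
def tightIdeal : TwoSidedIdeal (ContractedAlgebra K S) :=
  TwoSidedIdeal.span {a | ∃ (e : S) (F : List S), IsIdempotentElem e ∧ IsCover F e ∧
    a = ofS K e * (F.map fun f => ofS K e - ofS K f).prod}

/-- The set of singular elements of `K₀S`: those `a` such that every non-zero idempotent `e`
has a non-zero idempotent `f ≤ e` below it with `a f = 0`. -/
def singularIdeal : Set (ContractedAlgebra K S) :=
  {a | ∀ e : S, IsIdempotentElem e → e ≠ 0 →
    ∃ f : S, IsIdempotentElem f ∧ f ≠ 0 ∧ f * e = f ∧ a * ofS K f = 0}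

end Contracted

/-! ### The representation of `K₀S` on the space with basis the infinite words -/

section Rep

variable (K G X : Type*) [Field K] [Group G] [SelfSimilarGroup G X]

/-- The vector space `K X^ω` with basis the infinite words. -/
abbrev OmegaSpace : Type _ := Stream' X →₀ K

variable {G X}

/-- The operator on `K X^ω` given by `s ∈ S`: it maps the basis vector `w` to `s(w)` if this is
defined, and to `0` otherwise. -/
def omegaOp (s : InvSemi G X) : Module.End K (OmegaSpace K X) :=
  Finsupp.linearCombination K fun w =>
    (omegaPartial s w).elim 0 fun w' => Finsupp.single w' (1 : K)

theorem omegaOp_single (s : InvSemi G X) (w : Stream' X) :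
    omegaOp K s (Finsupp.single w 1) =
      (omegaPartial s w).elim 0 fun w' => Finsupp.single w' (1 : K) := by
  simp [omegaOp]

variable (G X)

/-- The action of `S` on `K X^ω`. -/
def omegaHom : InvSemi G X →*₀ Module.End K (OmegaSpace K X) where
  toFun := omegaOp K
  map_zero' := by
    apply Finsupp.lhom_ext'
    intro w
    ext : 1
    simp only [LinearMap.comp_apply, Finsupp.lsingle_apply, omegaOp_single]
    rfl
  map_one' := by
    apply Finsupp.lhom_ext'
    intro w
    ext : 1
    simp [LinearMap.comp_apply, Finsupp.lsingle_apply, omegaOp_single, omegaPartial_one]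
  map_mul' s t := by
    apply Finsupp.lhom_ext'
    intro w
    ext : 1
    simp only [LinearMap.comp_apply, Finsupp.lsingle_apply, omegaOp_single, omegaPartial_mul,
      Module.End.mul_apply]
    cases omegaPartial t w with
    | none => simp
    | some b => simp [omegaOp_single]

/-- The natural representation of `K₀S` on `K X^ω`. -/
def omegaRep : ContractedAlgebra K (InvSemi G X) →ₐ[K] Module.End K (OmegaSpace K X) :=
  contractedLift (omegaHom K G X)

variable {G X}

theorem omegaRep_ofS (s : InvSemi G X) : omegaRep K G X (ofS K s) = omegaOp K s :=
  contractedLift_ofS _ s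

end Rep

/-! ### The Nekrashevych algebra -/

/-- The generators `x`, `x*`, `g`, `g*` of the Nekrashevych algebra. -/
inductive NekGen (G X : Type*) : Type _
  | letter (x : X) : NekGen G X
  | letterStar (x : X) : NekGen G X
  | elt (g : G) : NekGen G X
  | eltStar (g : G) : NekGen G X

section Nek

variable (K : Type*) {G X : Type*} [Field K]

/-- The generator `x` of the free algebra. -/
abbrev genL (x : X) : FreeAlgebra K (NekGen G X) := FreeAlgebra.ι K (NekGen.letter x)

/-- The generator `x*` of the free algebra. -/
abbrev genLs (x : X) : FreeAlgebra K (NekGen G X) := FreeAlgebra.ι K (NekGen.letterStar x)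

/-- The generator `g` of the free algebra. -/
abbrev genE (g : G) : FreeAlgebra K (NekGen G X) := FreeAlgebra.ι K (NekGen.elt g)

/-- The generator `g*` of the free algebra. -/
abbrev genEs (g : G) : FreeAlgebra K (NekGen G X) := FreeAlgebra.ι K (NekGen.eltStar g)

variable (G X)
variable [Group G] [SelfSimilarGroup G X] [Fintype X]

/-- The defining relations of the Nekrashevych algebra as a `*`-algebra generated by `X` and `G`:
the identity of `G` is `1`, `g* = g⁻¹`, `g · h = gh`, `g x = g(x) g|ₓ`, `y* x = δ_{x,y}` and
`∑ x x* = 1`; together with the images of these relations under the involution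
(the relations `ck1`, `ck1_ne` and `ck2` are closed under it). -/
inductive NekRel : FreeAlgebra K (NekGen G X) → FreeAlgebra K (NekGen G X) → Prop
  | one : NekRel (genE K 1) 1
  | one_star : NekRel (genEs K 1) 1
  | inv (g : G) : NekRel (genEs K g) (genE K g⁻¹)
  | inv_star (g : G) : NekRel (genE K g) (genEs K g⁻¹)
  | mul (g h : G) : NekRel (genE K g * genE K h) (genE K (g * h))
  | mul_star (g h : G) : NekRel (genEs K h * genEs K g) (genEs K (g * h))
  | ss (g : G) (x : X) : NekRel (genE K g * genL K x) (genL K (letter g x) * genE K (sec g x))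
  | ss_star (g : G) (x : X) :
      NekRel (genLs K x * genEs K g) (genEs K (sec g x) * genLs K (letter g x))
  | ck1 (x : X) : NekRel (genLs K x * genL K x) 1
  | ck1_ne (x y : X) : x ≠ y → NekRel (genLs K y * genL K x) 0
  | ck2 : NekRel (∑ x : X, genL K x * genLs K x) 1

/-- The Nekrashevych algebra of the self-similar group `(G, X)` over `K`. -/
abbrev NekAlgebra : Type _ := RingQuot (NekRel K G X)

variable {G X}

/-- The element of the inverse semigroup that corresponds to a generator. -/
def NekGen.toInv : NekGen G X → InvSemi G X
  | .letter x => .mk [x] 1 []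
  | .letterStar x => .mk [] 1 [x]
  | .elt g => .mk [] g []
  | .eltStar g => .mk [] g⁻¹ []

theorem omegaOp_sum_letters :
    ∑ x : X, omegaOp K (InvSemi.mk [x] 1 [x] : InvSemi G X) = 1 := by
  apply Finsupp.lhom_ext'
  intro w
  ext : 1
  simp only [LinearMap.comp_apply, Finsupp.lsingle_apply, LinearMap.sum_apply, omegaOp_single,
    Module.End.one_apply]
  rw [Finset.sum_eq_single w.head]
  · have : omegaPartial (InvSemi.mk [w.head] (1 : G) [w.head]) w = some w := by
      rw [omegaPartial_eq_some]
      refine ⟨_, _, _, w.tail, rfl, ?_, ?_⟩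
      · exact (Stream'.append_stream_head_tail w).symm
      · simp only [omegaAct_one]
        exact (Stream'.append_stream_head_tail w).symm
    rw [this]
    rfl
  · intro x _ hx
    have : omegaPartial (InvSemi.mk [x] (1 : G) [x]) w = none := by
      rw [Option.eq_none_iff_forall_ne_some]
      intro b hb
      rw [omegaPartial_eq_some] at hb
      obtain ⟨_, _, _, c, h, h', _⟩ := hb
      cases h
      apply hx
      rw [h']
      rfl
    rw [this]
    rfl
  · intro h
    exact absurd (Finset.mem_univ _) h

/-- The representation of the free algebra on `K X^ω` that induces `nekRep`. -/
def freeRep : FreeAlgebra K (NekGen G X) →ₐ[K] Module.End K (OmegaSpace K X) :=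
  FreeAlgebra.lift K fun y => omegaHom K G X y.toInv

theorem freeRep_rel ⦃a b : FreeAlgebra K (NekGen G X)⦄ (h : NekRel K G X a b) :
    freeRep K a = freeRep K b := by
  induction h with
  | one =>
    simp only [freeRep, FreeAlgebra.lift_ι_apply, NekGen.toInv, map_one]
    exact map_one (omegaHom K G X)
  | one_star =>
    simp only [freeRep, FreeAlgebra.lift_ι_apply, NekGen.toInv, map_one, inv_one]
    exact map_one (omegaHom K G X)
  | inv g => simp [freeRep, NekGen.toInv]
  | inv_star g => simp [freeRep, NekGen.toInv]
  | mul g h =>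
    simp only [freeRep, map_mul, FreeAlgebra.lift_ι_apply, NekGen.toInv]
    simp [← map_mul, mk_mul_mk_nil, mk_nil_mul_mk, smul_nil, secW, smul_singleton]
  | mul_star g h =>
    simp only [freeRep, map_mul, FreeAlgebra.lift_ι_apply, NekGen.toInv]
    simp [← map_mul, mk_mul_mk_nil, mk_nil_mul_mk, smul_nil, secW, smul_singleton]
  | ss g x =>
    simp only [freeRep, map_mul, FreeAlgebra.lift_ι_apply, NekGen.toInv]
    simp [← map_mul, mk_mul_mk_nil, mk_nil_mul_mk, smul_nil, secW, smul_singleton]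
  | ss_star g x =>
    simp only [freeRep, map_mul, FreeAlgebra.lift_ι_apply, NekGen.toInv]
    simp [← map_mul, mk_mul_mk_nil, mk_nil_mul_mk, smul_nil, secW, smul_singleton]
  | ck1 x =>
    have := mk_mul_mk_left [] (1 : G) [x] [] 1 []
    simp only [List.append_nil, smul_nil, secW, mul_one] at this
    simp only [freeRep, map_mul, FreeAlgebra.lift_ι_apply, NekGen.toInv]
    rw [← map_mul, this, map_one]
    exact map_one (omegaHom K G X)
  | ck1_ne x y hxy =>
    have : InvSemi.mk [] (1 : G) [y] * InvSemi.mk [x] 1 [] = 0 :=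
      mk_mul_mk_incomp (by simpa using Ne.symm hxy) (by simpa using hxy)
    simp only [freeRep, map_mul, FreeAlgebra.lift_ι_apply, NekGen.toInv]
    rw [← map_mul, this, map_zero, map_zero]
  | ck2 =>
    have h : ∀ x : X, InvSemi.mk [x] (1 : G) [] * InvSemi.mk [] 1 [x] = InvSemi.mk [x] 1 [x] := by
      intro x
      simp [mk_mul_mk_nil, smul_nil, secW]
    simp only [freeRep, map_sum, map_mul, FreeAlgebra.lift_ι_apply, NekGen.toInv, map_one]
    simp only [← map_mul, h]
    exact omegaOp_sum_letters K

variable (G X)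

/-- The representation of the Nekrashevych algebra on `K X^ω`: the generators `x`, `x*`, `g`, `g*`
act by the corresponding partial maps of `X^ω`. -/
def nekRep : NekAlgebra K G X →ₐ[K] Module.End K (OmegaSpace K X) :=
  RingQuot.liftAlgHom K ⟨freeRep K, freeRep_rel K⟩

variable {G X}

/-- The element `x` of the Nekrashevych algebra. -/
def nekL (x : X) : NekAlgebra K G X := RingQuot.mkAlgHom K (NekRel K G X) (genL K x)

/-- The element `x*` of the Nekrashevych algebra. -/
def nekLs (x : X) : NekAlgebra K G X := RingQuot.mkAlgHom K (NekRel K G X) (genLs K x)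

/-- The element `g` of the Nekrashevych algebra. -/
def nekE (g : G) : NekAlgebra K G X := RingQuot.mkAlgHom K (NekRel K G X) (genE K g)

variable (G) in
/-- The element `w = x₁ ⋯ xₙ` of the Nekrashevych algebra. -/
def nekW (w : List X) : NekAlgebra K G X := (w.map (nekL K)).prod

variable (G) in
/-- The element `w* = xₙ* ⋯ x₁*` of the Nekrashevych algebra. -/
def nekWs (w : List X) : NekAlgebra K G X := (w.reverse.map (nekLs K)).prod

theorem nekE_one : nekE K (1 : G) = (1 : NekAlgebra K G X) := by
  simpa [nekE] using RingQuot.mkAlgHom_rel K (NekRel.one (K := K) (G := G) (X := X))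

theorem nekE_mul (g h : G) : (nekE K g * nekE K h : NekAlgebra K G X) = nekE K (g * h) := by
  simpa [nekE] using RingQuot.mkAlgHom_rel K (NekRel.mul (K := K) (X := X) g h)

theorem nekE_nekL (g : G) (x : X) :
    (nekE K g * nekL K x : NekAlgebra K G X) = nekL K (letter g x) * nekE K (sec g x) := by
  simpa [nekE, nekL] using RingQuot.mkAlgHom_rel K (NekRel.ss (K := K) g x)

theorem nekLs_nekE (g : G) (x : X) :
    (nekLs K x * nekE K g⁻¹ : NekAlgebra K G X) =
      nekE K (sec g x)⁻¹ * nekLs K (letter g x) := by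
  have h := RingQuot.mkAlgHom_rel K (NekRel.ss_star (K := K) g x)
  have h1 := RingQuot.mkAlgHom_rel K (NekRel.inv (K := K) (X := X) g)
  have h2 := RingQuot.mkAlgHom_rel K (NekRel.inv (K := K) (X := X) (sec g x))
  rw [map_mul, map_mul, h1, h2] at h
  exact h

theorem nekLs_nekL (x : X) : (nekLs K x * nekL K x : NekAlgebra K G X) = 1 := by
  simpa [nekLs, nekL] using RingQuot.mkAlgHom_rel K (NekRel.ck1 (K := K) (G := G) x)

theorem nekLs_nekL_ne {x y : X} (h : x ≠ y) :
    (nekLs K y * nekL K x : NekAlgebra K G X) = 0 := by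
  simpa [nekLs, nekL] using RingQuot.mkAlgHom_rel K (NekRel.ck1_ne (K := K) (G := G) x y h)

theorem nekW_append (u v : List X) : nekW K G (u ++ v) = nekW K G u * nekW K G v := by
  simp [nekW]

theorem nekWs_append (u v : List X) : nekWs K G (u ++ v) = nekWs K G v * nekWs K G u := by
  simp [nekWs]

theorem nekW_cons (x : X) (v : List X) : nekW K G (x :: v) = nekL K x * nekW K G v := by
  simp [nekW]

theorem nekWs_cons (x : X) (v : List X) : nekWs K G (x :: v) = nekWs K G v * nekLs K x := by
  simp [nekWs]

theorem nekW_nil : nekW K G ([] : List X) = 1 := rfl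

theorem nekWs_nil : nekWs K G ([] : List X) = 1 := rfl

theorem nekE_nekW (g : G) (w : List X) :
    nekE K g * nekW K G w = nekW K G (g • w) * nekE K (secW g w) := by
  induction w generalizing g with
  | nil => simp [nekW_nil, smul_nil, secW]
  | cons x w ih => rw [nekW_cons, ← mul_assoc, nekE_nekL, mul_assoc, ih, smul_cons, nekW_cons,
      mul_assoc, secW]

theorem nekWs_nekE (g : G) (w : List X) :
    nekWs K G w * nekE K g⁻¹ = nekE K (secW g w)⁻¹ * nekWs K G (g • w) := by
  induction w generalizing g with
  | nil => simp [nekWs_nil, smul_nil, secW]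
  | cons x w ih => rw [nekWs_cons, mul_assoc, nekLs_nekE, ← mul_assoc, ih, smul_cons, nekWs_cons,
      mul_assoc, secW]

theorem nekWs_nekW (w : List X) : nekWs K G w * nekW K G w = 1 := by
  induction w with
  | nil => simp [nekW_nil, nekWs_nil]
  | cons x w ih => rw [nekWs_cons, nekW_cons, mul_assoc, ← mul_assoc (nekLs K x), nekLs_nekL,
      one_mul, ih]

theorem nekWs_nekW_incomp {u v : List X} (h1 : ¬ u <+: v) (h2 : ¬ v <+: u) :
    nekWs K G u * nekW K G v = 0 := by
  induction u generalizing v with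
  | nil => exact absurd List.nil_prefix h1
  | cons x u ih =>
    cases v with
    | nil => exact absurd List.nil_prefix h2
    | cons y v =>
      rw [nekWs_cons, nekW_cons, mul_assoc, ← mul_assoc (nekLs K x)]
      by_cases h : y = x
      · subst h
        rw [nekLs_nekL, one_mul]
        apply ih
        · simpa using h1
        · simpa using h2
      · rw [nekLs_nekL_ne K h, zero_mul, mul_zero]

/-- The element `u g v*` of the Nekrashevych algebra. -/
def nekOf : InvSemi G X → NekAlgebra K G X
  | .zero => 0
  | .mk u g v => nekW K G u * nekE K g * nekWs K G v

theorem nekOf_mul (s t : InvSemi G X) : nekOf K (s * t) = nekOf K s * nekOf K t := by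
  rcases s with _ | ⟨u, g, v⟩
  · rw [zero_mul_aux]; simp [nekOf]
  rcases t with _ | ⟨u', g', v'⟩
  · rw [mul_zero_aux]; simp [nekOf]
  by_cases h1 : v <+: u'
  · obtain ⟨z, rfl⟩ := h1
    rw [mk_mul_mk_left]
    simp only [nekOf, nekW_append]
    calc _ = nekW K G u * (nekW K G (g • z) * nekE K (secW g z)) * nekE K g' * nekWs K G v' := by
          rw [← nekE_mul]; simp only [mul_assoc]
      _ = nekW K G u * nekE K g * 1 * nekW K G z * nekE K g' * nekWs K G v' := by
          rw [← nekE_nekW]; simp only [mul_assoc, one_mul]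
      _ = _ := by rw [← nekWs_nekW K v]; simp only [mul_assoc]
  by_cases h2 : u' <+: v
  · obtain ⟨z, rfl⟩ := h2
    rw [mk_mul_mk_right]
    simp only [nekOf, nekWs_append]
    have hz := nekWs_nekE K g'⁻¹ z
    rw [inv_inv] at hz
    calc _ = nekW K G u * nekE K g * (nekE K (secW g'⁻¹ z)⁻¹ * nekWs K G (g'⁻¹ • z)) *
            nekWs K G v' := by
          rw [← nekE_mul]; simp only [mul_assoc]
      _ = nekW K G u * nekE K g * nekWs K G z * 1 * nekE K g' * nekWs K G v' := by
          rw [← hz]; simp only [mul_assoc, one_mul]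
      _ = _ := by rw [← nekWs_nekW K u']; simp only [mul_assoc]
  · rw [mk_mul_mk_incomp h1 h2]
    simp only [nekOf]
    calc (0 : NekAlgebra K G X)
        = nekW K G u * nekE K g * (nekWs K G v * nekW K G u') * nekE K g' * nekWs K G v' := by
          rw [nekWs_nekW_incomp K h1 h2]; simp
      _ = _ := by simp only [mul_assoc]

variable (G X)

/-- The homomorphism from `S` to the Nekrashevych algebra. -/
def nekHom : InvSemi G X →*₀ NekAlgebra K G X where
  toFun := nekOf K
  map_zero' := rfl
  map_one' := by
    rw [InvSemi.one_def]
    simp [nekOf, nekW_nil, nekWs_nil, nekE_one]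
  map_mul' := nekOf_mul K

/-- The canonical homomorphism from `K₀S` to the Nekrashevych algebra, which maps the element
`u g v*` of `S` to the element `u g v*` of the Nekrashevych algebra. -/
def nekQuot : ContractedAlgebra K (InvSemi G X) →ₐ[K] NekAlgebra K G X :=
  contractedLift (nekHom K G X)

variable {G X}

theorem nekQuot_ofS (s : InvSemi G X) : nekQuot K G X (ofS K s) = nekOf K s :=
  contractedLift_ofS _ s

end Nek

end Nekrashevych
end

/-!
The elements of `S` act on `X^ω` by continuous partial maps, and distinct elements act differently.
For `s ∈ S` and `ξ, η ∈ X^ω` with prefixes `ξ_N` and `η_n` of length `N` and `n`, continuity gives,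
for `n` large and `N` large depending on `n`, that `η_n η_n* s ξ_N ξ_N*` is `s ξ_N ξ_N*` if `s`
maps `ξ` to `η`, and `0` otherwise. So these idempotents cut out of `a ∈ K₀S` the terms mapping `ξ`
to `η`. If `a` is singular, evaluating near `ξ` shows that the coefficients of these terms add up
to `0`. If `a` is not singular, after passing to a smaller cylinder its terms have distinct values
at every point, so a single term survives the cut, and it can be multiplied to `1`. Hence every `a`
outside `Sing` satisfies `p a q = 1` for some `p` and `q`, which gives both the kernel of the
representation and the simplicity criterion.

For the tight ideal, `𝒩` is universal for homomorphisms from `S` with `∑ x x* ↦ 1`. As the `x x*`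
are orthogonal, `1 - ∑ x x*` is the product of the `1 - x x*`, and the `x x*` cover `1`, so
`K₀S → K₀S / Tight` factors through `𝒩`. Conversely `∑ x x* = 1` splits an idempotent `w w*` into
the `(wz)(wz)*` with `z` of any given length, and each long enough `(wz)(wz)*` lies below some
element of a given cover, hence annihilates its tight product.
-/

namespace Nekrashevych

open Filter SelfSimilarGroup

section Idempotents

variable {G X : Type*} [Group G]

variable (G) in
/-- The idempotent `w w*` of `S`. By `exists_eq_idem` every non-zero idempotent is of this form. -/
def idem (w : List X) : InvSemi G X := .mk w 1 w

theorem idem_injective : Function.Injective (idem G : List X → InvSemi G X) := by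
  intro u w h
  injection h

variable [SelfSimilarGroup G X]

theorem idem_ne_zero (w : List X) : idem G w ≠ 0 := nofun

theorem idem_mul_idem_eq_left {u w : List X} (h : u <+: w) : idem G w * idem G u = idem G w := by
  obtain ⟨z, rfl⟩ := h
  simp only [idem, mk_mul_mk_right, inv_one, one_smul, secW_one, mul_one]

theorem idem_mul_idem_eq_right {u w : List X} (h : u <+: w) : idem G u * idem G w = idem G w := by
  obtain ⟨z, rfl⟩ := h
  simp only [idem, mk_mul_mk_left, one_smul, secW_one, mul_one]

theorem isIdempotentElem_idem (w : List X) : IsIdempotentElem (idem G w) :=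
  idem_mul_idem_eq_left List.prefix_rfl

theorem prefix_or_prefix_of_mk_mul_mk_ne_zero {u v u' v' : List X} {g g' : G}
    (h : InvSemi.mk u g v * InvSemi.mk u' g' v' ≠ 0) : v <+: u' ∨ u' <+: v := by
  by_contra! hc
  exact h (mk_mul_mk_incomp hc.1 hc.2)

theorem idem_mul_idem_eq_left_iff {u w : List X} : idem G w * idem G u = idem G w ↔ u <+: w := by
  refine ⟨fun h => ?_, idem_mul_idem_eq_left⟩
  rcases prefix_or_prefix_of_mk_mul_mk_ne_zero (h.symm ▸ idem_ne_zero w) with hwu | huw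
  · rw [idem_mul_idem_eq_right hwu] at h
    exact (idem_injective h) ▸ List.prefix_rfl
  · exact huw

theorem eq_of_isIdempotentElem_mk {u v : List X} {g : G}
    (h : IsIdempotentElem (InvSemi.mk u g v)) : u = v := by
  have hmul : InvSemi.mk u g v * InvSemi.mk u g v = InvSemi.mk u g v := h
  have eq_nil_of_smul_eq_nil (g : G) (z : List X) (hz : g • z = []) : z = [] := by
    rw [← inv_smul_smul g z, hz, smul_nil]
  rcases prefix_or_prefix_of_mk_mul_mk_ne_zero (hmul.trans_ne nofun) with ⟨z, rfl⟩ | ⟨z, rfl⟩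
  · rw [mk_mul_mk_left] at hmul
    injection hmul with hleft
    rw [eq_nil_of_smul_eq_nil g z (List.append_right_eq_self.1 hleft), List.append_nil]
  · rw [mk_mul_mk_right] at hmul
    injection hmul with _ _ hright
    rw [eq_nil_of_smul_eq_nil g⁻¹ z (List.append_right_eq_self.1 hright), List.append_nil]

theorem exists_eq_idem {e : InvSemi G X} (he : IsIdempotentElem e) (h0 : e ≠ 0) :
    ∃ w, e = idem G w := by
  rcases e with _ | ⟨u, g, v⟩
  · exact absurd rfl h0
  obtain rfl := eq_of_isIdempotentElem_mk he
  have hmul := mk_mul_mk_left u g u [] g u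
  rw [List.append_nil, he.eq, smul_nil, secW, List.append_nil] at hmul
  injection hmul with _ hg
  exact ⟨u, by rw [idem, mul_eq_left.1 hg.symm]⟩

end Idempotents

section Cylinders

variable {X : Type*}

/-- The cylinder set of a finite word `w`: the infinite words with prefix `w`. -/
def cylinder (w : List X) : Set (Stream' X) := {ξ | ξ.take w.length = w}

theorem mem_cylinder {w : List X} {ξ : Stream' X} : ξ ∈ cylinder w ↔ ξ.take w.length = w := Iff.rfl

theorem append_mem_cylinder (w : List X) (ξ : Stream' X) : (w ++ₛ ξ) ∈ cylinder w :=
  take_append_aux w ξ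

theorem cylinder_nonempty [Nonempty X] (w : List X) : (cylinder w).Nonempty :=
  ⟨_, append_mem_cylinder w (Stream'.const (Classical.arbitrary X))⟩

theorem exists_eq_append_of_mem_cylinder {w : List X} {ξ : Stream' X} (h : ξ ∈ cylinder w) :
    ∃ ζ, ξ = w ++ₛ ζ :=
  ⟨ξ.drop w.length, by conv_lhs => rw [← Stream'.append_take_drop w.length ξ, mem_cylinder.1 h]⟩

theorem mem_cylinder_iff_prefix_take {w : List X} {ξ : Stream' X} {n : ℕ} (h : w.length ≤ n) :
    ξ ∈ cylinder w ↔ w <+: ξ.take n := by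
  rw [List.prefix_iff_eq_take, Stream'.take_take, min_eq_right h, eq_comm, mem_cylinder]

theorem cylinder_anti {u w : List X} (h : u <+: w) : cylinder w ⊆ cylinder u := fun _ hξ =>
  (mem_cylinder_iff_prefix_take h.length_le).2 ((mem_cylinder.1 hξ).symm ▸ h)

theorem mem_cylinder_take {ξ ζ : Stream' X} {n : ℕ} :
    ζ ∈ cylinder (ξ.take n) ↔ ζ.take n = ξ.take n := by
  rw [mem_cylinder, Stream'.length_take]

theorem self_mem_cylinder_take (ξ : Stream' X) (n : ℕ) : ξ ∈ cylinder (ξ.take n) :=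
  mem_cylinder_take.2 rfl

theorem prefix_of_cylinder_subset [Nontrivial X] {u w : List X} (h : cylinder w ⊆ cylinder u) :
    u <+: w := by
  -- A letter of `u` beyond `w` would have to be equal to every letter of the alphabet.
  rcases le_or_gt u.length w.length with hle | hlt
  · obtain ⟨ξ, hξ⟩ := cylinder_nonempty w
    rw [← mem_cylinder.1 hξ]
    exact (mem_cylinder_iff_prefix_take hle).1 (h hξ)
  · obtain ⟨a, ha⟩ := exists_ne u[w.length]
    obtain ⟨ζ, hζ⟩ :=
      exists_eq_append_of_mem_cylinder (h (append_mem_cylinder w (Stream'.const a)))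
    have hget := congrArg (Stream'.get · w.length) hζ
    rw [Stream'.get_append_length, Stream'.get_const, Stream'.get_append_left _ _ _ hlt] at hget
    exact absurd hget ha

theorem cylinder_injective [Nontrivial X] :
    Function.Injective (cylinder : List X → Set (Stream' X)) := by
  intro u w h
  have huw := prefix_of_cylinder_subset h.ge
  exact huw.eq_of_length_le (prefix_of_cylinder_subset h.le).length_le

end Cylinders

section PartialMaps

variable {G X : Type*} [Group G] [SelfSimilarGroup G X]

theorem omegaPartial_mk_append (u : List X) (g : G) (v : List X) (ξ : Stream' X) :
    omegaPartial (InvSemi.mk u g v) (v ++ₛ ξ) = some (u ++ₛ omegaAct g ξ) := by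
  rw [omegaPartial, if_pos (take_append_aux v ξ), Stream'.drop_append_stream]

theorem omegaPartial_mk_eq_some_iff {u v : List X} {g : G} {ξ η : Stream' X} :
    omegaPartial (InvSemi.mk u g v) ξ = some η ↔
      ∃ ζ, ξ = (v ++ₛ ζ) ∧ η = (u ++ₛ omegaAct g ζ) := by
  rw [omegaPartial_eq_some]
  constructor
  · rintro ⟨_, _, _, ζ, h, hξ, hη⟩
    cases h
    exact ⟨ζ, hξ, hη⟩
  · rintro ⟨ζ, hξ, hη⟩
    exact ⟨u, g, v, ζ, rfl, hξ, hη⟩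

theorem isSome_omegaPartial_mk_iff {u v : List X} {g : G} {ξ : Stream' X} :
    (omegaPartial (InvSemi.mk u g v) ξ).isSome ↔ ξ ∈ cylinder v := by
  rw [omegaPartial, mem_cylinder]
  split_ifs with h <;> simp [h]

theorem omegaPartial_mk_inv {u v : List X} {g : G} {ξ η : Stream' X} :
    omegaPartial (InvSemi.mk v g⁻¹ u) η = some ξ ↔
      omegaPartial (InvSemi.mk u g v) ξ = some η := by
  simp only [omegaPartial_mk_eq_some_iff]
  constructor
  · rintro ⟨ζ, rfl, rfl⟩
    exact ⟨omegaAct g⁻¹ ζ, rfl, by rw [← omegaAct_mul, mul_inv_cancel, omegaAct_one]⟩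
  · rintro ⟨ζ, rfl, rfl⟩
    exact ⟨omegaAct g ζ, rfl, by rw [← omegaAct_mul, inv_mul_cancel, omegaAct_one]⟩

theorem omegaPartial_idem {w : List X} {ξ : Stream' X} (h : ξ ∈ cylinder w) :
    omegaPartial (idem G w) ξ = some ξ := by
  obtain ⟨ζ, rfl⟩ := exists_eq_append_of_mem_cylinder h
  rw [idem, omegaPartial_mk_append, omegaAct_one]

theorem omegaPartial_idem_of_notMem {w : List X} {ξ : Stream' X} (h : ξ ∉ cylinder w) :
    omegaPartial (idem G w) ξ = none :=
  if_neg h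

theorem omegaPartial_mul_idem (s : InvSemi G X) {w : List X} {ξ : Stream' X}
    (h : ξ ∈ cylinder w) : omegaPartial (s * idem G w) ξ = omegaPartial s ξ := by
  rw [omegaPartial_mul, omegaPartial_idem h, Option.bind_some]

theorem omegaPartial_mul_idem_of_notMem (s : InvSemi G X) {w : List X} {ξ : Stream' X}
    (h : ξ ∉ cylinder w) : omegaPartial (s * idem G w) ξ = none := by
  rw [omegaPartial_mul, omegaPartial_idem_of_notMem h, Option.bind_none]

theorem omegaPartial_idem_mul_of_isSome {s : InvSemi G X} {w : List X} {ξ : Stream' X}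
    (h : (omegaPartial (idem G w * s) ξ).isSome) :
    omegaPartial (idem G w * s) ξ = omegaPartial s ξ := by
  rw [omegaPartial_mul] at h ⊢
  obtain ⟨η, hη⟩ := Option.isSome_iff_exists.1 (Option.isSome_of_isSome_bind h)
  rw [hη, Option.bind_some] at h ⊢
  exact omegaPartial_idem (isSome_omegaPartial_mk_iff.1 h)

theorem isSome_omegaPartial_idem_take_mul_iff {s : InvSemi G X} {ξ η : Stream' X} {n : ℕ} :
    (omegaPartial (idem G (η.take n) * s) ξ).isSome ↔
      (omegaPartial s ξ).map (Stream'.take n) = some (η.take n) := by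
  rw [omegaPartial_mul]
  cases omegaPartial s ξ with
  | none => simp
  | some θ => simp [idem, isSome_omegaPartial_mk_iff, mem_cylinder_take]

end PartialMaps

section Faithful

variable {G X : Type*} [Group G] [SelfSimilarGroup G X]

theorem eq_of_omegaAct_eq [Nonempty X] {g h : G}
    (heq : ∀ ξ : Stream' X, omegaAct g ξ = omegaAct h ξ) : g = h := by
  apply faithful (X := X)
  intro w
  obtain ⟨ξ, hξ⟩ := cylinder_nonempty w
  rw [← mem_cylinder.1 hξ, smul_take, smul_take, heq]

theorem source_eq_of_omegaPartial_eq [Nontrivial X] {u v u' v' : List X} {g g' : G}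
    (h : ∀ ξ, omegaPartial (InvSemi.mk u g v) ξ = omegaPartial (InvSemi.mk u' g' v') ξ) :
    v = v' :=
  cylinder_injective <| Set.ext fun ξ => by
    rw [← isSome_omegaPartial_mk_iff (u := u) (g := g), h, isSome_omegaPartial_mk_iff]

theorem eq_of_omegaPartial_eq [Nontrivial X] {s t : InvSemi G X}
    (h : ∀ ξ, omegaPartial s ξ = omegaPartial t ξ) : s = t := by
  obtain ⟨ζ, -⟩ := cylinder_nonempty ([] : List X)
  rcases s with _ | ⟨u, g, v⟩ <;> rcases t with _ | ⟨u', g', v'⟩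
  · rfl
  · exact absurd ((h _).trans (omegaPartial_mk_append u' g' v' ζ)) nofun
  · exact absurd ((h _).symm.trans (omegaPartial_mk_append u g v ζ)) nofun
  · obtain rfl := source_eq_of_omegaPartial_eq h
    have hinv : ∀ η, omegaPartial (InvSemi.mk v g⁻¹ u) η =
        omegaPartial (InvSemi.mk v g'⁻¹ u') η := fun η => by
      ext ξ
      rw [omegaPartial_mk_inv, h, omegaPartial_mk_inv]
    obtain rfl := source_eq_of_omegaPartial_eq hinv
    congr 1
    refine eq_of_omegaAct_eq fun ξ => Stream'.append_right_injective u _ _ ?_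
    simpa only [omegaPartial_mk_append, Option.some.injEq] using h (v ++ₛ ξ)

theorem mul_idem_eq_mul_idem [Nontrivial X] {s t : InvSemi G X} {w : List X}
    (h : ∀ ξ ∈ cylinder w, omegaPartial s ξ = omegaPartial t ξ) : s * idem G w = t * idem G w := by
  refine eq_of_omegaPartial_eq fun ξ => ?_
  by_cases hξ : ξ ∈ cylinder w
  · rw [omegaPartial_mul_idem s hξ, omegaPartial_mul_idem t hξ, h ξ hξ]
  · rw [omegaPartial_mul_idem_of_notMem s hξ, omegaPartial_mul_idem_of_notMem t hξ]

end Faithful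

section Continuity

variable {G X : Type*} [Group G] [SelfSimilarGroup G X]

theorem take_eq_take_of_le {ξ ζ : Stream' X} {m n : ℕ} (hmn : m ≤ n) (h : ξ.take n = ζ.take n) :
    ξ.take m = ζ.take m := by
  rw [← min_eq_right hmn, ← Stream'.take_take, h, Stream'.take_take]

theorem eventually_map_take_ne {a b : Option (Stream' X)} (h : a ≠ b) :
    ∀ᶠ n in atTop, a.map (Stream'.take n) ≠ b.map (Stream'.take n) := by
  rcases a with _ | ξ <;> rcases b with _ | ζ
  · exact absurd rfl h
  · exact .of_forall fun _ => nofun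
  · exact .of_forall fun _ => nofun
  · obtain ⟨m, hm⟩ : ∃ m, ξ.take m ≠ ζ.take m := by
      by_contra! heq
      exact h (congrArg some (Stream'.take_theorem ξ ζ heq))
    filter_upwards [eventually_ge_atTop m] with n hn heq
    exact hm (take_eq_take_of_le hn (Option.some.inj heq))

theorem eventually_map_take_omegaPartial_eq (s : InvSemi G X) (ξ : Stream' X) (n : ℕ) :
    ∀ᶠ N in atTop, ∀ ζ ∈ cylinder (ξ.take N),
      (omegaPartial s ζ).map (Stream'.take n) = (omegaPartial s ξ).map (Stream'.take n) := by
  rcases s with _ | ⟨u, g, v⟩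
  · exact .of_forall fun _ _ _ => rfl
  filter_upwards [eventually_ge_atTop (v.length + n)] with N hN ζ hζ
  have htake := take_eq_take_of_le hN (mem_cylinder_take.1 hζ)
  rw [Stream'.take_add, Stream'.take_add] at htake
  obtain ⟨hv, hn⟩ := List.append_inj htake (by simp only [Stream'.length_take])
  by_cases hξ : ξ.take v.length = v
  · rw [omegaPartial, omegaPartial, if_pos (hv.trans hξ), if_pos hξ]
    refine congrArg some (take_eq_take_of_le (Nat.le_add_left n u.length) ?_)
    simp only [Stream'.take_add, take_append_aux, Stream'.drop_append_stream, ← smul_take, hn]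
  · rw [omegaPartial, omegaPartial, if_neg (hv.trans_ne hξ), if_neg hξ]

theorem eventually_omegaPartial_ne {s t : InvSemi G X} {ξ : Stream' X}
    (h : omegaPartial s ξ ≠ omegaPartial t ξ) :
    ∀ᶠ N in atTop, ∀ ζ ∈ cylinder (ξ.take N), omegaPartial s ζ ≠ omegaPartial t ζ := by
  obtain ⟨n, hn⟩ := (eventually_map_take_ne h).exists
  filter_upwards [eventually_map_take_omegaPartial_eq s ξ n,
    eventually_map_take_omegaPartial_eq t ξ n] with N hs ht ζ hζ heq
  exact hn (by rw [← hs ζ hζ, ← ht ζ hζ, heq])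

theorem eventually_isSome_omegaPartial_idem_take_mul_iff (s : InvSemi G X) (ξ η : Stream' X) :
    ∀ᶠ n in atTop, ∀ᶠ N in atTop, ∀ ζ ∈ cylinder (ξ.take N),
      (omegaPartial (idem G (η.take n) * s) ζ).isSome ↔ omegaPartial s ξ = some η := by
  have hξ : ∀ᶠ n in atTop, (omegaPartial s ξ).map (Stream'.take n) = some (η.take n) ↔
      omegaPartial s ξ = some η := by
    by_cases h : omegaPartial s ξ = some η
    · simp [h]
    · filter_upwards [eventually_map_take_ne h] with n hn
      exact iff_of_false hn h
  filter_upwards [hξ] with n hn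
  filter_upwards [eventually_map_take_omegaPartial_eq s ξ n] with N hN ζ hζ
  rw [isSome_omegaPartial_idem_take_mul_iff, hN ζ hζ, hn]

open scoped Classical in
theorem eventually_idem_take_mul_mul_idem_take [Nontrivial X] (s : InvSemi G X)
    (ξ η : Stream' X) :
    ∀ᶠ n in atTop, ∀ᶠ N in atTop, idem G (η.take n) * s * idem G (ξ.take N) =
      if omegaPartial s ξ = some η then s * idem G (ξ.take N) else 0 := by
  filter_upwards [eventually_isSome_omegaPartial_idem_take_mul_iff s ξ η] with n hn
  filter_upwards [hn] with N hN
  split_ifs with h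
  · exact mul_idem_eq_mul_idem fun ζ hζ => omegaPartial_idem_mul_of_isSome ((hN ζ hζ).2 h)
  · rw [← zero_mul (idem G (ξ.take N))]
    exact mul_idem_eq_mul_idem fun ζ hζ => Option.not_isSome_iff_eq_none.1 (mt (hN ζ hζ).1 h)

end Continuity

section Separation

variable {G X : Type*} [Group G] [SelfSimilarGroup G X]

/-- The elements `s` and `t` of `S` either agree on the cylinder of `w` or differ at every point
of it. -/
def Separated (w : List X) (s t : InvSemi G X) : Prop :=
  s * idem G w = t * idem G w ∨ ∀ ξ ∈ cylinder w, omegaPartial s ξ ≠ omegaPartial t ξ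

theorem Separated.mono {u w : List X} {s t : InvSemi G X} (hs : Separated u s t) (h : u <+: w) :
    Separated w s t := by
  refine hs.imp (fun heq => ?_) fun hne ξ hξ => hne ξ (cylinder_anti h hξ)
  rw [← idem_mul_idem_eq_right h, ← mul_assoc, heq, mul_assoc]

theorem Separated.mul_idem_eq {w : List X} {s t : InvSemi G X} (h : Separated w s t)
    {ξ : Stream' X} (hξ : ξ ∈ cylinder w) (heq : omegaPartial s ξ = omegaPartial t ξ) :
    s * idem G w = t * idem G w :=
  h.resolve_right fun hne => hne ξ hξ heq

theorem exists_prefix_separated [Nontrivial X] (u : List X) (s t : InvSemi G X) :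
    ∃ w, u <+: w ∧ Separated w s t := by
  by_cases h : ∀ ξ ∈ cylinder u, omegaPartial s ξ = omegaPartial t ξ
  · exact ⟨u, List.prefix_rfl, Or.inl (mul_idem_eq_mul_idem h)⟩
  · push Not at h
    obtain ⟨ξ, hξ, hne⟩ := h
    obtain ⟨N, hN, hu⟩ :=
      ((eventually_omegaPartial_ne hne).and (eventually_ge_atTop u.length)).exists
    exact ⟨ξ.take N, (mem_cylinder_iff_prefix_take hu).1 hξ, Or.inr hN⟩

theorem exists_prefix_forall_mem_finset {ι : Type*} {P : ι → List X → Prop}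
    (mono : ∀ i u w, P i u → u <+: w → P i w) (dense : ∀ i u, ∃ w, u <+: w ∧ P i w)
    (T : Finset ι) (u : List X) : ∃ w, u <+: w ∧ ∀ i ∈ T, P i w := by
  induction T using Finset.cons_induction with
  | empty => exact ⟨u, List.prefix_rfl, by simp⟩
  | cons i T _ ih =>
    obtain ⟨v, huv, hv⟩ := ih
    obtain ⟨w, hvw, hw⟩ := dense i v
    exact ⟨w, huv.trans hvw,
      (Finset.forall_mem_cons _ _).2 ⟨hw, fun j hj => mono j v w (hv j hj) hvw⟩⟩

theorem exists_prefix_forall_separated [Nontrivial X] (u : List X) (T : Finset (InvSemi G X)) :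
    ∃ w, u <+: w ∧ ∀ s ∈ T, ∀ t ∈ T, Separated w s t := by
  obtain ⟨w, huw, hw⟩ := exists_prefix_forall_mem_finset
    (P := fun (p : InvSemi G X × InvSemi G X) w => Separated w p.1 p.2)
    (fun _ _ _ hs h => hs.mono h) (fun p u => exists_prefix_separated u p.1 p.2) (T ×ˢ T) u
  exact ⟨w, huw, fun s hs t ht => hw (s, t) (Finset.mk_mem_product hs ht)⟩

end Separation

section ContractedAlgebra

variable {K S : Type*} [Field K] [MonoidWithZero S]

variable (K S) in
/-- The canonical map from `S` to its contracted algebra `K₀S`, as a homomorphism. -/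
noncomputable def ofHom : S →*₀ ContractedAlgebra K S where
  toFun := ofS K
  map_zero' := by
    refine Ideal.Quotient.eq_zero_iff_mem.2 fun s hs => ?_
    simp [Ne.symm hs]
  map_one' := map_one (Ideal.Quotient.mk (zeroIdeal K S))
  map_mul' s t := by simp only [ofS, map_mul]

variable (K) in
theorem ofS_mul (s t : S) : ofS K (s * t) = ofS K s * ofS K t := map_mul (ofHom K S) s t

theorem ofS_zero : ofS K (0 : S) = 0 := map_zero (ofHom K S)

theorem ofS_one : ofS K (1 : S) = 1 := map_one (ofHom K S)

variable (K S) in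
theorem span_range_ofS :
    Submodule.span K (Set.range (ofS K : S → ContractedAlgebra K S)) = ⊤ := by
  refine Submodule.eq_top_iff'.2 fun a => ?_
  obtain ⟨b, rfl⟩ := Ideal.Quotient.mkₐ_surjective K (zeroIdeal K S) a
  induction b using MonoidAlgebra.induction_on with
  | of s => exact Submodule.subset_span ⟨s, rfl⟩
  | add x y hx hy => rw [map_add]; exact add_mem hx hy
  | smul r x hx => rw [map_smul]; exact Submodule.smul_mem _ r hx

theorem algHom_ext_ofS {A : Type*} [Semiring A] [Algebra K A]
    {f g : ContractedAlgebra K S →ₐ[K] A} (h : ∀ s, f (ofS K s) = g (ofS K s)) : f = g :=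
  AlgHom.toLinearMap_injective (LinearMap.ext_on_range (span_range_ofS K S) h)

end ContractedAlgebra

section Kernel

variable {K G X : Type*} [Field K] [Group G] [SelfSimilarGroup G X]

theorem mem_singularIdeal_iff {a : ContractedAlgebra K (InvSemi G X)} :
    a ∈ singularIdeal K (InvSemi G X) ↔ ∀ u, ∃ w, u <+: w ∧ a * ofS K (idem G w) = 0 := by
  constructor
  · intro ha u
    obtain ⟨f, hf, hf0, hfe, haf⟩ := ha (idem G u) (isIdempotentElem_idem u) (idem_ne_zero u)
    obtain ⟨w, rfl⟩ := exists_eq_idem hf hf0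
    exact ⟨w, idem_mul_idem_eq_left_iff.1 hfe, haf⟩
  · intro ha e he he0
    obtain ⟨u, rfl⟩ := exists_eq_idem he he0
    obtain ⟨w, huw, haw⟩ := ha u
    exact ⟨idem G w, isIdempotentElem_idem w, idem_ne_zero w, idem_mul_idem_eq_left huw, haw⟩

open scoped Classical in
theorem omegaOp_single_apply (s : InvSemi G X) (ξ η : Stream' X) :
    omegaOp K s (Finsupp.single ξ 1) η = if omegaPartial s ξ = some η then 1 else 0 := by
  rw [omegaOp_single]
  cases omegaPartial s ξ with
  | none => simp
  | some θ => simp [Finsupp.single_apply]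

theorem omegaOp_idem_single {w : List X} {ξ : Stream' X} (h : ξ ∈ cylinder w) :
    omegaOp K (idem G w) (Finsupp.single ξ 1) = Finsupp.single ξ 1 := by
  rw [omegaOp_single, omegaPartial_idem h, Option.elim_some]

variable (K X) in
/-- The linear functional on `K X^ω` that sends a vector to the sum of its coefficients. -/
noncomputable def augmentation : OmegaSpace K X →ₗ[K] K := Finsupp.linearCombination K fun _ => 1

theorem augmentation_omegaOp_single (s : InvSemi G X) (ξ : Stream' X) :
    augmentation K X (omegaOp K s (Finsupp.single ξ 1)) =
      if (omegaPartial s ξ).isSome then 1 else 0 := by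
  rw [omegaOp_single]
  cases omegaPartial s ξ <;> simp [augmentation]

/-- The coefficient of `a ξ` at `η` is not locally constant in `ξ`; the total mass of `a ξ` in a
small cylinder around `η` is. -/
theorem eventually_augmentation_eq (a : ContractedAlgebra K (InvSemi G X)) (ξ η : Stream' X) :
    ∀ᶠ n in atTop, ∀ᶠ N in atTop, ∀ ζ ∈ cylinder (ξ.take N),
      augmentation K X (omegaRep K G X (ofS K (idem G (η.take n)) * a) (Finsupp.single ζ 1)) =
        omegaRep K G X a (Finsupp.single ξ 1) η := by
  classical
  have ha : a ∈ Submodule.span K (Set.range (ofS K)) := by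
    rw [span_range_ofS]
    exact Submodule.mem_top
  induction ha using Submodule.span_induction with
  | mem _ hs =>
    obtain ⟨s, rfl⟩ := hs
    filter_upwards [eventually_isSome_omegaPartial_idem_take_mul_iff s ξ η] with n hn
    filter_upwards [hn] with N hN ζ hζ
    rw [← ofS_mul, omegaRep_ofS, omegaRep_ofS, augmentation_omegaOp_single, omegaOp_single_apply,
      if_congr (hN ζ hζ) rfl rfl]
  | zero => simp
  | add a b _ _ ha hb =>
    filter_upwards [ha, hb] with n ha hb
    filter_upwards [ha, hb] with N ha hb ζ hζ
    simp only [mul_add, map_add, LinearMap.add_apply, Finsupp.add_apply, ha ζ hζ, hb ζ hζ]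
  | smul r a _ ha =>
    filter_upwards [ha] with n ha
    filter_upwards [ha] with N ha ζ hζ
    simp only [mul_smul_comm, map_smul, LinearMap.smul_apply, Finsupp.smul_apply, ha ζ hζ]

theorem omegaRep_eq_zero_of_mem_singularIdeal {a : ContractedAlgebra K (InvSemi G X)}
    (ha : a ∈ singularIdeal K (InvSemi G X)) : omegaRep K G X a = 0 := by
  ext ξ η
  obtain ⟨n, hn⟩ := (eventually_augmentation_eq a ξ η).exists
  obtain ⟨N, hN⟩ := hn.exists
  obtain ⟨w, hw, haw⟩ := mem_singularIdeal_iff.1 ha (ξ.take N)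
  have hζ := append_mem_cylinder w ξ
  have hmul : omegaRep K G X (ofS K (idem G (η.take n)) * a) (Finsupp.single (w ++ₛ ξ) 1) = 0 := by
    rw [← omegaOp_idem_single (G := G) hζ, ← omegaRep_ofS, ← Module.End.mul_apply, ← map_mul,
      mul_assoc, haw, mul_zero, map_zero, LinearMap.zero_apply]
  have hη := hN _ (cylinder_anti hw hζ)
  rw [hmul, map_zero] at hη
  exact hη.symm

end Kernel

section Compression

variable {K G X : Type*} [Field K] [Group G] [SelfSimilarGroup G X]

theorem exists_mul_mul_eq_one {s : InvSemi G X} (hs : s ≠ 0) : ∃ t r, t * s * r = 1 := by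
  rcases s with _ | ⟨u, g, v⟩
  · exact absurd rfl hs
  have hleft := mk_mul_mk_left [] g⁻¹ u [] g v
  have hright := mk_mul_mk_left [] (1 : G) v [] 1 []
  simp only [List.append_nil, smul_nil, secW, inv_mul_cancel, mul_one] at hleft hright
  exact ⟨.mk [] g⁻¹ u, .mk v 1 [], by rw [hleft, hright, InvSemi.one_def]⟩

theorem ne_zero_of_omegaPartial_eq_some {s : InvSemi G X} {ξ η : Stream' X}
    (h : omegaPartial s ξ = some η) : s ≠ 0 := by
  rintro rfl
  exact absurd h nofun

/-- As `0` is the nowhere defined map, inserting it into the support says that the values of the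
elements of the support at `ξ` are not only distinct but also defined. -/
theorem exists_prefix_mul_idem_eq_linearCombination [Nontrivial X]
    (a : ContractedAlgebra K (InvSemi G X)) (u : List X) :
    ∃ w, u <+: w ∧ ∃ c : InvSemi G X →₀ K,
      a * ofS K (idem G w) = Finsupp.linearCombination K (ofS K) c ∧
        ∀ ξ ∈ cylinder w,
          Set.InjOn (omegaPartial · ξ) (insert 0 c.support : Set (InvSemi G X)) := by
  classical
  have ha : a ∈ Submodule.span K (Set.range (ofS K)) := by
    rw [span_range_ofS]
    exact Submodule.mem_top
  obtain ⟨c, rfl⟩ := Finsupp.mem_span_range_iff_exists_finsupp.1 ha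
  obtain ⟨w, huw, hw⟩ := exists_prefix_forall_separated u (insert 0 c.support)
  refine ⟨w, huw, c.mapDomain (· * idem G w), ?_, fun ξ hξ => ?_⟩
  · rw [Finsupp.linearCombination_mapDomain, Finsupp.linearCombination_apply, Finsupp.sum_mul]
    simp only [Function.comp_apply, ofS_mul, smul_mul_assoc]
  · have hsub : (insert 0 (c.mapDomain (· * idem G w)).support : Set (InvSemi G X)) ⊆
        (· * idem G w) '' (insert 0 c.support : Finset (InvSemi G X)) := by
      rw [Finset.coe_insert, Set.image_insert_eq, zero_mul, ← Finset.coe_image]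
      exact Set.insert_subset_insert (Finset.coe_subset.2 Finsupp.mapDomain_support)
    refine Set.InjOn.mono hsub ?_
    rintro _ ⟨s, hs, rfl⟩ _ ⟨t, ht, rfl⟩ hst
    simp only [omegaPartial_mul_idem _ hξ] at hst
    exact (hw s hs t ht).mul_idem_eq hξ hst

theorem exists_mul_mul_linearCombination_eq_one [Nontrivial X] {c : InvSemi G X →₀ K}
    {s : InvSemi G X} (hs : c s ≠ 0) {ξ η : Stream' X} (hη : omegaPartial s ξ = some η)
    (hinj : Set.InjOn (omegaPartial · ξ) (c.support : Set (InvSemi G X))) :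
    ∃ p q, p * Finsupp.linearCombination K (ofS K) c * q = 1 := by
  classical
  obtain ⟨n, hn⟩ := ((Filter.eventually_all_finset c.support).2 fun t _ =>
    eventually_idem_take_mul_mul_idem_take t ξ η).exists
  obtain ⟨N, hN⟩ := ((Filter.eventually_all_finset c.support).2 hn).exists
  set r := s * idem G (ξ.take N)
  have hcompress : ofS K (idem G (η.take n)) * Finsupp.linearCombination K (ofS K) c *
      ofS K (idem G (ξ.take N)) = c s • ofS K r := by
    have hterm : ∀ t ∈ c.support, ofS K (idem G (η.take n)) * (c t • ofS K t) *
        ofS K (idem G (ξ.take N)) = if t = s then c s • ofS K r else 0 := by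
      intro t ht
      rw [mul_smul_comm, smul_mul_assoc, ← ofS_mul, ← ofS_mul, hN t ht]
      split_ifs with h h' h'
      · rw [h']
      · exact absurd (hinj ht (Finsupp.mem_support_iff.2 hs) (h.trans hη.symm)) h'
      · exact absurd (h' ▸ hη) h
      · rw [ofS_zero, smul_zero]
    rw [Finsupp.linearCombination_apply, Finsupp.sum, Finset.mul_sum, Finset.sum_mul,
      Finset.sum_congr rfl hterm, Finset.sum_ite_eq', if_pos (Finsupp.mem_support_iff.2 hs)]
  have hr : omegaPartial r ξ = some η := by
    rw [omegaPartial_mul_idem s (self_mem_cylinder_take ξ N), hη]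
  obtain ⟨x, y, hxy⟩ := exists_mul_mul_eq_one (ne_zero_of_omegaPartial_eq_some hr)
  refine ⟨(c s)⁻¹ • ofS K x * ofS K (idem G (η.take n)), ofS K (idem G (ξ.take N)) * ofS K y, ?_⟩
  calc _ = (c s)⁻¹ • (ofS K x * (ofS K (idem G (η.take n)) *
          Finsupp.linearCombination K (ofS K) c * ofS K (idem G (ξ.take N))) * ofS K y) := by
        simp only [smul_mul_assoc, mul_assoc]
    _ = (c s)⁻¹ • c s • ofS K (x * r * y) := by
        rw [hcompress, mul_smul_comm, smul_mul_assoc, ofS_mul K (x * r) y, ofS_mul K x r]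
    _ = 1 := by rw [hxy, ofS_one, inv_smul_smul₀ hs]

theorem exists_mul_mul_eq_one_of_notMem_singularIdeal [Nontrivial X]
    {a : ContractedAlgebra K (InvSemi G X)} (ha : a ∉ singularIdeal K (InvSemi G X)) :
    ∃ p q, p * a * q = 1 := by
  simp only [mem_singularIdeal_iff, not_forall, not_exists, not_and] at ha
  obtain ⟨u, hu⟩ := ha
  obtain ⟨w, huw, c, hc, hinj⟩ := exists_prefix_mul_idem_eq_linearCombination a u
  obtain ⟨s, hs, hs0⟩ : ∃ s ∈ c.support, s ≠ 0 := by
    by_contra! hzero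
    refine hu w huw (hc.trans (Finset.sum_eq_zero fun s hs => ?_))
    simp [hzero s hs, ofS_zero]
  obtain ⟨ξ, hξ⟩ := cylinder_nonempty w
  obtain ⟨η, hη⟩ : ∃ η, omegaPartial s ξ = some η :=
    Option.ne_none_iff_exists'.1 fun hnone =>
      hs0 (hinj ξ hξ (Set.mem_insert_of_mem 0 hs) (Set.mem_insert 0 _) hnone)
  obtain ⟨p, q, hpq⟩ := exists_mul_mul_linearCombination_eq_one (Finsupp.mem_support_iff.1 hs) hη
    ((hinj ξ hξ).mono (Set.subset_insert 0 _))
  exact ⟨p, ofS K (idem G w) * q, by rw [← mul_assoc, mul_assoc p, hc, hpq]⟩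

instance [Nonempty X] : Nontrivial (Module.End K (OmegaSpace K X)) :=
  have : Nonempty (Stream' X) := (cylinder_nonempty []).to_type
  inferInstance

theorem omegaRep_eq_zero_iff [Nontrivial X] {a : ContractedAlgebra K (InvSemi G X)} :
    omegaRep K G X a = 0 ↔ a ∈ singularIdeal K (InvSemi G X) := by
  refine ⟨fun ha => ?_, omegaRep_eq_zero_of_mem_singularIdeal⟩
  by_contra hmem
  obtain ⟨p, q, hpq⟩ := exists_mul_mul_eq_one_of_notMem_singularIdeal hmem
  refine one_ne_zero (α := Module.End K (OmegaSpace K X)) ?_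
  rw [← map_one (omegaRep K G X), ← hpq, map_mul, map_mul, ha, mul_zero, zero_mul]

end Compression

section CuntzRelation

theorem mul_list_prod_eq_zero {M : Type*} [MonoidWithZero M] {p : M} {L : List M}
    (hL : ∀ a ∈ L, p * a = p ∨ p * a = 0) (h0 : ∃ a ∈ L, p * a = 0) : p * L.prod = 0 := by
  induction L with
  | nil => simp at h0
  | cons b L ih =>
    rw [List.forall_mem_cons] at hL
    rw [List.exists_mem_cons_iff] at h0
    rw [List.prod_cons, ← mul_assoc]
    by_cases hb : p * b = 0
    · rw [hb, zero_mul]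
    · rw [hL.1.resolve_right hb, ih hL.2 (h0.resolve_left hb)]

theorem exists_forall_idem_mem_length_le {G X : Type*} [Group G] (F : List (InvSemi G X)) :
    ∃ n, ∀ v, idem G v ∈ F → v.length ≤ n := by
  obtain ⟨n, hn⟩ := ((F.finite_toSet.preimage idem_injective.injOn).image List.length).bddAbove
  exact ⟨n, fun v hv => hn (Set.mem_image_of_mem _ hv)⟩

variable {G X A : Type*} [Group G] [SelfSimilarGroup G X]

theorem idem_mul_idem_eq_left_or_eq_zero {v w : List X} (h : v.length ≤ w.length) :
    idem G w * idem G v = idem G w ∨ idem G w * idem G v = 0 := by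
  refine or_iff_not_imp_right.2 fun hne => idem_mul_idem_eq_left ?_
  rcases prefix_or_prefix_of_mk_mul_mk_ne_zero hne with hwv | hvw
  · exact (hwv.eq_of_length_le h) ▸ List.prefix_rfl
  · exact hvw

variable [Fintype X]

theorem sum_map_idem_append_singleton [Semiring A] {h : InvSemi G X →*₀ A}
    (hsum : ∑ x, h (idem G [x]) = 1) (u : List X) :
    ∑ x, h (idem G (u ++ [x])) = h (idem G u) := by
  have hidem (w : List X) :
      InvSemi.mk u 1 [] * idem G w * InvSemi.mk [] 1 u = idem G (u ++ w) := by
    simp only [idem, mk_mul_mk_nil, mk_nil_mul_mk, one_smul, inv_one, secW_one, mul_one]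
  calc ∑ x, h (idem G (u ++ [x]))
      = h (.mk u 1 []) * (∑ x, h (idem G [x])) * h (.mk [] 1 u) := by
        simp only [← hidem, map_mul, Finset.mul_sum, Finset.sum_mul]
    _ = h (idem G u) := by
        rw [hsum, mul_one, ← map_mul, mk_mul_mk_nil, smul_nil, secW, List.append_nil, mul_one, idem]

theorem map_idem_mul_eq_zero [Semiring A] {h : InvSemi G X →*₀ A}
    (hsum : ∑ x, h (idem G [x]) = 1) {b : A} (n : ℕ) (u : List X)
    (hb : ∀ z : List X, z.length = n → h (idem G (u ++ z)) * b = 0) : h (idem G u) * b = 0 := by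
  induction n generalizing u with
  | zero => simpa using hb [] rfl
  | succ n ih =>
    rw [← sum_map_idem_append_singleton hsum, Finset.sum_mul]
    refine Finset.sum_eq_zero fun x _ => ih _ fun z hz => ?_
    rw [← List.append_cons]
    exact hb (x :: z) (by rw [List.length_cons, hz])

theorem map_mul_prod_sub_eq_zero [Ring A] {h : InvSemi G X →*₀ A}
    (hsum : ∑ x, h (idem G [x]) = 1) {e : InvSemi G X} {F : List (InvSemi G X)}
    (he : IsIdempotentElem e) (hF : IsCover F e) :
    h e * (F.map fun f => h e - h f).prod = 0 := by
  by_cases h0 : e = 0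
  · rw [h0, map_zero, zero_mul]
  obtain ⟨u, rfl⟩ := exists_eq_idem he h0
  obtain ⟨n, hn⟩ := exists_forall_idem_mem_length_le F
  -- An idempotent `q` of a long word is minimal relative to `F`: each `q * f` is `q` or `0`.
  refine map_idem_mul_eq_zero hsum n u fun z hz => ?_
  set q := idem G (u ++ z)
  have hqu : q * idem G u = q := idem_mul_idem_eq_left (List.prefix_append u z)
  have hmul (f : InvSemi G X) : h q * (h (idem G u) - h f) = h q - h (q * f) := by
    rw [mul_sub, ← map_mul, ← map_mul, hqu]
  have hq (f : InvSemi G X) (hf : f ∈ F) : q * f = q ∨ q * f = 0 := by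
    by_cases hf0 : f = 0
    · exact .inr (by rw [hf0, mul_zero])
    obtain ⟨v, rfl⟩ := exists_eq_idem (hF.idempotent f hf) hf0
    have hlen := hn v hf
    exact idem_mul_idem_eq_left_or_eq_zero (by rw [List.length_append]; omega)
  apply mul_list_prod_eq_zero
  · rw [List.forall_mem_map]
    intro f hf
    rw [hmul]
    rcases hq f hf with hqf | hqf
    · exact .inr (by rw [hqf, sub_self])
    · exact .inl (by rw [hqf, map_zero, sub_zero])
  · obtain ⟨f, hf, hqf⟩ := hF.meets q (isIdempotentElem_idem _) (idem_ne_zero _) hqu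
    refine ⟨_, List.mem_map_of_mem hf, ?_⟩
    rw [hmul, (hq f hf).resolve_right hqf, sub_self]

end CuntzRelation

section UniversalProperty

variable {G X A : Type*} [Group G] [SelfSimilarGroup G X] [Semiring A]

theorem mk_eq_mul_mul (u : List X) (g : G) (v : List X) :
    InvSemi.mk u g v = InvSemi.mk u 1 [] * InvSemi.mk [] g [] * InvSemi.mk [] 1 v := by
  simp only [mk_mul_mk_nil, smul_nil, secW, List.append_nil, one_mul, mul_one]

theorem map_mk_cons (h : InvSemi G X →*₀ A) (x : X) (w : List X) :
    h (.mk (x :: w) 1 []) = h (.mk [x] 1 []) * h (.mk w 1 []) := by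
  rw [← map_mul, mk_mul_mk_nil, one_smul, secW_one, mul_one, List.singleton_append]

theorem map_mk_cons_star (h : InvSemi G X →*₀ A) (x : X) (w : List X) :
    h (.mk [] 1 (x :: w)) = h (.mk [] 1 w) * h (.mk [] 1 [x]) := by
  rw [← map_mul, mk_nil_mul_mk, inv_one, one_smul, secW_one, inv_one, mul_one,
    List.singleton_append]

variable {K : Type*} [Field K] [Fintype X] [Algebra K A]

theorem map_nekOf {h : InvSemi G X →*₀ A} {f : NekAlgebra K G X →ₐ[K] A}
    (hf : ∀ y, f (RingQuot.mkAlgHom K (NekRel K G X) (FreeAlgebra.ι K y)) = h y.toInv)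
    (s : InvSemi G X) : f (nekOf K s) = h s := by
  have hnil : h (.mk [] 1 []) = 1 := map_one h
  have hW (w : List X) : f (nekW K G w) = h (.mk w 1 []) := by
    induction w with
    | nil => rw [nekW_nil, map_one, hnil]
    | cons x w ih => rw [nekW_cons, map_mul, ih, map_mk_cons, nekL, hf, NekGen.toInv]
  have hWs (w : List X) : f (nekWs K G w) = h (.mk [] 1 w) := by
    induction w with
    | nil => rw [nekWs_nil, map_one, hnil]
    | cons x w ih => rw [nekWs_cons, map_mul, ih, map_mk_cons_star, nekLs, hf, NekGen.toInv]
  rcases s with _ | ⟨u, g, v⟩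
  · exact (map_zero f).trans (map_zero h).symm
  · rw [nekOf, map_mul, map_mul, hW, hWs, nekE, hf, NekGen.toInv, mk_eq_mul_mul u g v, map_mul,
      map_mul]

theorem lift_toInv_eq_of_nekRel {h : InvSemi G X →*₀ A} (hsum : ∑ x, h (idem G [x]) = 1)
    {a b : FreeAlgebra K (NekGen G X)} (hab : NekRel K G X a b) :
    FreeAlgebra.lift K (fun y => h y.toInv) a = FreeAlgebra.lift K (fun y => h y.toInv) b := by
  have hnil : h (.mk [] 1 []) = 1 := map_one h
  induction hab with
  | one | one_star => simp [NekGen.toInv, hnil]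
  | inv | inv_star => simp [NekGen.toInv]
  | mul | mul_star | ss | ss_star =>
    simp only [map_mul, FreeAlgebra.lift_ι_apply, NekGen.toInv]
    simp [← map_mul, mk_mul_mk_nil, mk_nil_mul_mk, smul_nil, secW, smul_singleton]
  | ck1 x =>
    have hx := mk_mul_mk_left [] (1 : G) [x] [] 1 []
    simp only [List.append_nil, smul_nil, secW, mul_one] at hx
    simp only [map_mul, FreeAlgebra.lift_ι_apply, NekGen.toInv]
    rw [← map_mul, hx, map_one, hnil]
  | ck1_ne x y hxy =>
    have hyx : InvSemi.mk [] (1 : G) [y] * InvSemi.mk [x] 1 [] = 0 :=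
      mk_mul_mk_incomp (by simpa using hxy.symm) (by simpa using hxy)
    simp only [map_mul, FreeAlgebra.lift_ι_apply, NekGen.toInv]
    rw [← map_mul, hyx, map_zero, map_zero]
  | ck2 =>
    have hidem (x : X) : InvSemi.mk [x] (1 : G) [] * InvSemi.mk [] 1 [x] = idem G [x] := by
      simp only [mk_mul_mk_nil, smul_nil, secW, List.append_nil, mul_one, idem]
    simp only [map_sum, map_mul, FreeAlgebra.lift_ι_apply, NekGen.toInv, map_one]
    simp only [← map_mul, hidem, hsum]

/-- The universal property of the Nekrashevych algebra: a homomorphism from `S` to a `K`-algebra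
with `∑ x x* ↦ 1` factors through it. -/
noncomputable def nekLift (h : InvSemi G X →*₀ A) (hsum : ∑ x, h (idem G [x]) = 1) :
    NekAlgebra K G X →ₐ[K] A :=
  RingQuot.liftAlgHom K
    ⟨FreeAlgebra.lift K fun y => h y.toInv, fun _ _ => lift_toInv_eq_of_nekRel hsum⟩

theorem nekLift_nekOf (h : InvSemi G X →*₀ A) (hsum : ∑ x, h (idem G [x]) = 1)
    (s : InvSemi G X) : nekLift (K := K) h hsum (nekOf K s) = h s :=
  map_nekOf (fun y => by
    rw [nekLift, RingQuot.liftAlgHom_mkAlgHom_apply, FreeAlgebra.lift_ι_apply]) s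

end UniversalProperty

section Quotient

variable {K G X : Type*} [Field K] [Group G] [SelfSimilarGroup G X] [Fintype X]

theorem nekRep_nekOf (s : InvSemi G X) : nekRep K G X (nekOf K s) = omegaOp K s :=
  map_nekOf (h := omegaHom K G X) (fun y => by
    rw [nekRep, RingQuot.liftAlgHom_mkAlgHom_apply, freeRep, FreeAlgebra.lift_ι_apply]) s

theorem nekRep_comp_nekQuot : (nekRep K G X).comp (nekQuot K G X) = omegaRep K G X :=
  algHom_ext_ofS fun s => by
    rw [AlgHom.comp_apply, nekQuot_ofS, nekRep_nekOf, omegaRep_ofS]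

theorem nekRep_nekQuot (a : ContractedAlgebra K (InvSemi G X)) :
    nekRep K G X (nekQuot K G X a) = omegaRep K G X a :=
  DFunLike.congr_fun nekRep_comp_nekQuot a

theorem mkAlgHom_ι (y : NekGen G X) :
    RingQuot.mkAlgHom K (NekRel K G X) (FreeAlgebra.ι K y) = nekOf K y.toInv := by
  cases y with
  | letter x => simp [NekGen.toInv, nekOf, nekE_one, nekW, nekWs, nekL]
  | letterStar x => simp [NekGen.toInv, nekOf, nekE_one, nekW, nekWs, nekLs]
  | elt g => simp [NekGen.toInv, nekOf, nekW, nekWs, nekE]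
  | eltStar g =>
    simpa [NekGen.toInv, nekOf, nekW, nekWs, nekE] using
      RingQuot.mkAlgHom_rel K (NekRel.inv (K := K) (X := X) g)

theorem nekQuot_surjective : Function.Surjective (nekQuot K G X) := by
  intro b
  obtain ⟨b, rfl⟩ := RingQuot.mkAlgHom_surjective K (NekRel K G X) b
  change _ ∈ (nekQuot K G X).range
  induction b using FreeAlgebra.induction with
  | grade0 r =>
    rw [AlgHom.commutes]
    exact Subalgebra.algebraMap_mem _ r
  | grade1 y =>
    rw [mkAlgHom_ι]
    exact ⟨ofS K y.toInv, nekQuot_ofS K _⟩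
  | mul a b ha hb =>
    rw [map_mul]
    exact mul_mem ha hb
  | add a b ha hb =>
    rw [map_add]
    exact add_mem ha hb

theorem sum_nekHom_idem_singleton : ∑ x, nekHom K G X (idem G [x]) = 1 := by
  have hck : ∑ x, nekL K x * nekLs K x = (1 : NekAlgebra K G X) := by
    simpa [nekL, nekLs] using RingQuot.mkAlgHom_rel K (NekRel.ck2 (K := K) (G := G) (X := X))
  rw [← hck]
  refine Finset.sum_congr rfl fun x _ => ?_
  change nekW K G [x] * nekE K 1 * nekWs K G [x] = _
  rw [nekE_one, mul_one, nekW_cons, nekWs_cons, nekW_nil, nekWs_nil, mul_one, one_mul]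

end Quotient

section Tight

theorem prod_one_sub_of_pairwise {R : Type*} [Ring R] {L : List R}
    (hL : L.Pairwise fun a b => a * b = 0) : (L.map (1 - ·)).prod = 1 - L.sum := by
  induction L with
  | nil => simp
  | cons a L ih =>
    rw [List.pairwise_cons] at hL
    have ha : a * L.sum = 0 := by
      rw [← List.map_id' L, ← List.sum_map_mul_left]
      exact List.sum_eq_zero (List.forall_mem_map.2 hL.1)
    rw [List.map_cons, List.prod_cons, ih hL.2, List.sum_cons, sub_mul, one_mul, mul_sub, mul_one,
      ha, sub_zero, sub_sub, add_comm]

variable {G X : Type*} [Group G] [SelfSimilarGroup G X] [Fintype X]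

theorem isCover_idem_singleton [Nonempty X] :
    IsCover ((Finset.univ : Finset X).toList.map fun x => idem G [x]) (1 : InvSemi G X) where
  idempotent := by
    rw [List.forall_mem_map]
    exact fun x _ => isIdempotentElem_idem [x]
  le f _ := mul_one f
  meets f hf hf0 _ := by
    obtain ⟨w, rfl⟩ := exists_eq_idem hf hf0
    suffices ∃ x, idem G w * idem G [x] ≠ 0 from
      this.imp' (fun x => idem G [x]) fun x hx =>
        ⟨List.mem_map_of_mem (Finset.mem_toList.2 (Finset.mem_univ x)), hx⟩
    cases w with
    | nil =>
      obtain ⟨x⟩ := ‹Nonempty X›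
      exact ⟨x, (idem_mul_idem_eq_right List.nil_prefix).trans_ne (idem_ne_zero [x])⟩
    | cons x w =>
      exact ⟨x, (idem_mul_idem_eq_left (List.prefix_append [x] w)).trans_ne (idem_ne_zero _)⟩

variable {K : Type*} [Field K]

theorem one_sub_sum_mem_tightIdeal [Nonempty X] :
    1 - ∑ x : X, ofS K (idem G [x]) ∈ tightIdeal K (InvSemi G X) := by
  refine TwoSidedIdeal.subset_span ⟨1, _, IsIdempotentElem.one, isCover_idem_singleton, ?_⟩
  have hortho : ((Finset.univ : Finset X).toList.map fun x => ofS K (idem G [x])).Pairwise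
      fun a b => a * b = 0 :=
    List.pairwise_map.2 <| (Finset.nodup_toList _).imp fun {x y} hxy => by
      rw [← ofS_mul, idem, idem, mk_mul_mk_incomp (by simpa using hxy) (by simpa using hxy.symm)]
      exact ofS_zero
  have hprod := prod_one_sub_of_pairwise hortho
  rw [Finset.sum_map_toList, List.map_map] at hprod
  rw [List.map_map, ofS_one, one_mul, ← hprod]
  rfl

theorem ker_nekQuot_le_tightIdeal [Nonempty X] :
    TwoSidedIdeal.ker (nekQuot K G X) ≤ tightIdeal K (InvSemi G X) := by
  intro a ha
  set I := (tightIdeal K (InvSemi G X)).asIdeal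
  set π := Ideal.Quotient.mkₐ K I
  have hπ (b) : π b = 0 ↔ b ∈ tightIdeal K (InvSemi G X) :=
    Ideal.Quotient.eq_zero_iff_mem.trans TwoSidedIdeal.mem_asIdeal
  let h : InvSemi G X →*₀ ContractedAlgebra K (InvSemi G X) ⧸ I :=
    π.toRingHom.toMonoidWithZeroHom.comp (ofHom K (InvSemi G X))
  have hsum : ∑ x, h (idem G [x]) = 1 := by
    have hone := (hπ _).2 one_sub_sum_mem_tightIdeal
    rw [map_sub, map_one, map_sum, sub_eq_zero] at hone
    exact hone.symm
  have hfactor : (nekLift h hsum).comp (nekQuot K G X) = π := algHom_ext_ofS fun s => by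
    rw [AlgHom.comp_apply, nekQuot_ofS, nekLift_nekOf]
    rfl
  rw [← hπ, ← hfactor, AlgHom.comp_apply, (TwoSidedIdeal.mem_ker _).1 ha, map_zero]

theorem tightIdeal_le_ker_nekQuot :
    tightIdeal K (InvSemi G X) ≤ TwoSidedIdeal.ker (nekQuot K G X) := by
  rw [tightIdeal, TwoSidedIdeal.span_le]
  rintro _ ⟨e, F, he, hF, rfl⟩
  rw [SetLike.mem_coe, TwoSidedIdeal.mem_ker, map_mul, map_list_prod, List.map_map,
    ← map_mul_prod_sub_eq_zero sum_nekHom_idem_singleton he hF]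
  simp only [Function.comp_def, map_sub, nekQuot_ofS]
  rfl

theorem ker_nekQuot [Nonempty X] :
    TwoSidedIdeal.ker (nekQuot K G X) = tightIdeal K (InvSemi G X) :=
  le_antisymm ker_nekQuot_le_tightIdeal tightIdeal_le_ker_nekQuot

end Tight

section Simplicity

theorem isSimpleRing_of_forall_exists_mul_mul_eq_one {R : Type*} [NonAssocRing R] [Nontrivial R]
    (h : ∀ a : R, a ≠ 0 → ∃ p q, p * a * q = 1) : IsSimpleRing R := by
  refine .of_eq_bot_or_eq_top fun I => or_iff_not_imp_left.2 fun hI => ?_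
  obtain ⟨a, ha, ha0⟩ : ∃ a ∈ I, a ≠ 0 := by
    by_contra! hzero
    exact hI (eq_bot_iff.2 fun a ha => (TwoSidedIdeal.mem_bot _).2 (hzero a ha))
  obtain ⟨p, q, hpq⟩ := h a ha0
  refine eq_top_iff.2 fun b _ => ?_
  rw [← mul_one b, ← hpq]
  exact I.mul_mem_left _ _ (I.mul_mem_right _ _ (I.mul_mem_left _ _ ha))

variable {K G X : Type*} [Field K] [Group G] [SelfSimilarGroup G X] [Fintype X] [Nontrivial X]

theorem ker_nekRep :
    (TwoSidedIdeal.ker (nekRep K G X) : Set (NekAlgebra K G X)) =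
      nekQuot K G X '' singularIdeal K (InvSemi G X) := by
  ext b
  obtain ⟨a, rfl⟩ := nekQuot_surjective b
  rw [SetLike.mem_coe, TwoSidedIdeal.mem_ker]
  constructor
  · intro ha
    exact ⟨a, omegaRep_eq_zero_iff.1 ((nekRep_nekQuot a).symm.trans ha), rfl⟩
  · rintro ⟨a', ha', heq⟩
    rw [← heq, nekRep_nekQuot, omegaRep_eq_zero_iff.2 ha']

theorem exists_mul_mul_eq_one_of_nekRep_ne_zero {b : NekAlgebra K G X}
    (hb : nekRep K G X b ≠ 0) : ∃ p q, p * b * q = 1 := by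
  obtain ⟨a, rfl⟩ := nekQuot_surjective b
  rw [nekRep_nekQuot, Ne, omegaRep_eq_zero_iff] at hb
  obtain ⟨p, q, hpq⟩ := exists_mul_mul_eq_one_of_notMem_singularIdeal hb
  exact ⟨nekQuot K G X p, nekQuot K G X q, by rw [← map_mul, ← map_mul, hpq, map_one]⟩

theorem isSimpleRing_nekAlgebra_iff :
    IsSimpleRing (NekAlgebra K G X) ↔ Function.Injective (nekRep K G X) := by
  refine ⟨fun _ => (nekRep K G X).toRingHom.injective, fun hinj => ?_⟩
  have : Nontrivial (NekAlgebra K G X) := (nekRep K G X).toRingHom.domain_nontrivial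
  refine isSimpleRing_of_forall_exists_mul_mul_eq_one fun b hb =>
    exists_mul_mul_eq_one_of_nekRep_ne_zero ?_
  exact (map_ne_zero_iff _ hinj).2 hb

end Simplicity

end Nekrashevych

theorem mainTheorem3 (K G X : Type*) [Field K] [Group G] [Fintype X] [Nontrivial X]
    [Nekrashevych.SelfSimilarGroup G X] :
    -- the kernel of the representation of `K₀S` on `K X^ω` is the singular ideal
    (TwoSidedIdeal.ker (Nekrashevych.omegaRep K G X) :
        Set (Nekrashevych.ContractedAlgebra K (Nekrashevych.InvSemi G X))) =
      Nekrashevych.singularIdeal K (Nekrashevych.InvSemi G X) ∧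
    -- the canonical map from `K₀S` identifies the Nekrashevych algebra with `K₀S / Tight`,
    -- and the representation of the Nekrashevych algebra is induced by that of `K₀S`
    Function.Surjective (Nekrashevych.nekQuot K G X) ∧
    TwoSidedIdeal.ker (Nekrashevych.nekQuot K G X) =
      Nekrashevych.tightIdeal K (Nekrashevych.InvSemi G X) ∧
    (Nekrashevych.nekRep K G X).comp (Nekrashevych.nekQuot K G X) =
      Nekrashevych.omegaRep K G X ∧
    -- the kernel of the representation of the Nekrashevych algebra is `Sing / Tight`
    (Nekrashevych.tightIdeal K (Nekrashevych.InvSemi G X) :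
        Set (Nekrashevych.ContractedAlgebra K (Nekrashevych.InvSemi G X))) ⊆
      Nekrashevych.singularIdeal K (Nekrashevych.InvSemi G X) ∧
    (TwoSidedIdeal.ker (Nekrashevych.nekRep K G X) : Set (Nekrashevych.NekAlgebra K G X)) =
      Nekrashevych.nekQuot K G X '' Nekrashevych.singularIdeal K (Nekrashevych.InvSemi G X) ∧
    -- the Nekrashevych algebra is simple if and only if its representation is faithful
    (IsSimpleRing (Nekrashevych.NekAlgebra K G X) ↔
      Function.Injective (Nekrashevych.nekRep K G X)) := by
  have hker := Nekrashevych.ker_nekQuot (K := K) (G := G) (X := X)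
  refine ⟨?_, Nekrashevych.nekQuot_surjective, hker, Nekrashevych.nekRep_comp_nekQuot, ?_,
    Nekrashevych.ker_nekRep, Nekrashevych.isSimpleRing_nekAlgebra_iff⟩
  · ext a
    rw [SetLike.mem_coe, TwoSidedIdeal.mem_ker, Nekrashevych.omegaRep_eq_zero_iff]
  · intro a ha
    rw [← hker, SetLike.mem_coe, TwoSidedIdeal.mem_ker] at ha
    rw [← Nekrashevych.omegaRep_eq_zero_iff, ← Nekrashevych.nekRep_nekQuot, ha, map_zero]
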